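/- Let $n\ge 1$ and let $\gamma$ be the standard Gaussian measure on $\mathbb R^n$ with the Euclidean norm. For probability measures $\mu,\nu$ on $\mathbb R^n$ let $$W_2(\mu,\nu)=\inf_\pi\Big(\int \tfrac12|x-y|^2\,d\pi(x,y)\Big)^{1/2},$$ the infimum being taken over all couplings $\pi$ of $\mu$ and $\nu$ (note the factor $\tfrac12$ in the cost). A probability density with respect to $\gamma$ is a measurable $h\ge 0$ with $\int h\,d\gamma=1$; for such $h$ let $\mathrm{Ent}_\gamma(h)=\int h\log h\,d\gamma\in[0,+\infty]$. (1) (Refined Talagrand inequality.) For every probability density $h$ with respect to $\gamma$ that is of class $C^2$ and satisfies $\Delta h\in L^1(\gamma)$, $$W_2^2(h\gamma,\gamma)\le \frac12\int\Delta h\,d\gamma+n\Big(1-\exp\Big(\frac1{2n}\int\Delta h\,d\gamma-\frac1n\mathrm{Ent}_\gamma(h)\Big)\Big),$$ where the exponential is $0$ if $\mathrm{Ent}_\gamma(h)=+\infty$. (2) Inequality (1) implies the classical Talagrand inequality: for every probability density $h$ with respect to $\gamma$, $$W_2^2(h\gamma,\gamma)\le \mathrm{Ent}_\gamma(h).$$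 (3) Inequality (1) implies the refined Poincaré inequality: for every $f\in C^2(\mathbb R^n)$ with $\Delta f\in L^1(\gamma)$, $$\mathrm{Var}_\gamma(f)\le\int|\nabla f|^2\,d\gamma-\frac1{2n}\Big(\int\Delta f\,d\gamma\Big)^2,$$ where both sides may be $+\infty$, and $\mathrm{Var}_\gamma(f)<\infty$ whenever $\int|\nabla f|^2\,d\gamma<\infty$. -/

import Mathlib

open MeasureTheory ProbabilityTheory
open scoped ENNReal

noncomputable section

namespace GaussTransport

/-- `π` is a coupling of `μ` and `ν`: its marginals are `μ` and `ν`. -/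
def IsCoupling {E : Type*} [MeasurableSpace E] (π : Measure (E × E)) (μ ν : Measure E) : Prop :=
  π.fst = μ ∧ π.snd = ν

/-- The quadratic Wasserstein distance with the normalisation of the cost by `1/2`:
`W₂(μ, ν) = inf_π (∫ d(x, y)² / 2 dπ(x, y))^{1/2}` over all couplings `π`. -/
def W2 {E : Type*} [PseudoEMetricSpace E] [MeasurableSpace E] (μ ν : Measure E) : ℝ≥0∞ :=
  ⨅ (π : Measure (E × E)) (_ : IsCoupling π μ ν),
    (∫⁻ p, edist p.1 p.2 ^ 2 / 2 ∂π) ^ (1 / 2 : ℝ)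

open Classical in
/-- `Ent_μ(h) = ∫ h log h dμ - (∫ h dμ) log (∫ h dμ)`. For a nonnegative `μ`-integrable `h` and a
finite measure `μ` the negative part of `h log h` is bounded, so that `∫ h log h dμ = +∞` when
`h log h` is not integrable. -/
def Ent {E : Type*} [MeasurableSpace E] (μ : Measure E) (h : E → ℝ) : EReal :=
  if Integrable (fun x => h x * Real.log (h x)) μ then
    ((∫ x, h x * Real.log (h x) ∂μ - (∫ x, h x ∂μ) * Real.log (∫ x, h x ∂μ) : ℝ) : EReal)
  else ⊤

/-- `h` is a probability density with respect to `μ` (a function with `∫ h dμ = 1` is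
automatically integrable). -/
def IsProbDensity {E : Type*} [MeasurableSpace E] (μ : Measure E) (h : E → ℝ) : Prop :=
  Measurable h ∧ (∀ x, 0 ≤ h x) ∧ ∫ x, h x ∂μ = 1

/-- The measure `hμ`. -/
def densMeasure {E : Type*} [MeasurableSpace E] (μ : Measure E) (h : E → ℝ) : Measure E :=
  μ.withDensity fun x => ENNReal.ofReal (h x)

/-- The standard Gaussian measure on `ℝⁿ`. -/
abbrev gauss (n : ℕ) : Measure (EuclideanSpace ℝ (Fin n)) :=
  stdGaussian (EuclideanSpace ℝ (Fin n))

/-- The refined Talagrand inequality for the standard Gaussian measure, for all `C²` probability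
densities with an integrable Laplacian. If the entropy is infinite then the exponential is `0`. -/
def RefinedTalagrand (n : ℕ) : Prop :=
  ∀ h : EuclideanSpace ℝ (Fin n) → ℝ,
    IsProbDensity (gauss n) h → ContDiff ℝ 2 h → Integrable (Laplacian.laplacian h) (gauss n) →
    ((W2 (densMeasure (gauss n) h) (gauss n) ^ 2 : ℝ≥0∞) : EReal) ≤
      ((1 / 2 * ∫ x, Laplacian.laplacian h x ∂(gauss n) : ℝ) : EReal) +
        (n : EReal) * (1 - (EReal.exp
          (((1 / (2 * n) * ∫ x, Laplacian.laplacian h x ∂(gauss n) : ℝ) : EReal) -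
            ((1 / n : ℝ) : EReal) * Ent (gauss n) h) : EReal))

/-- The classical Talagrand inequality, for all probability densities. -/
def ClassicalTalagrand (n : ℕ) : Prop :=
  ∀ h : EuclideanSpace ℝ (Fin n) → ℝ, IsProbDensity (gauss n) h →
    ((W2 (densMeasure (gauss n) h) (gauss n) ^ 2 : ℝ≥0∞) : EReal) ≤ Ent (gauss n) h

/-- The refined Poincaré inequality, for all `C²` functions with an integrable Laplacian. Variance
and Dirichlet integral take values in `[0, ∞]`; in particular the variance is finite as soon as
the Dirichlet integral is. -/
def RefinedPoincare (n : ℕ) : Prop :=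
  ∀ f : EuclideanSpace ℝ (Fin n) → ℝ,
    ContDiff ℝ 2 f → Integrable (Laplacian.laplacian f) (gauss n) →
    (evariance f (gauss n) : EReal) ≤
      ((∫⁻ x, ‖gradient f x‖ₑ ^ 2 ∂(gauss n) : ℝ≥0∞) : EReal) -
        ((1 / (2 * n) * (∫ x, Laplacian.laplacian f x ∂(gauss n)) ^ 2 : ℝ) : EReal)

end GaussTransport

end

/-!
For a density `h`, transport `h γ` to `γ` triangularly: the marginal of all coordinates but the
first by induction, and the conditional densities of the first one on the line by their monotone
rearrangements `T`. If `μ` is such a conditional law with density `k` and `S = T⁻¹`, Stein's formula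
for `γ` says that the correlation `∫ t T(t) dμ = ∫ y S(y) dγ` is `∫ S' dγ`, and
`S'(T t) = φ(T t) / (φ(t) k(t))` for the Gaussian density `φ`. To avoid differentiating `T` or `S`,
this is read as `∫ t T(t) dμ = ∫ (∫_{x > s} T dμ) ds` with `∫_{x > s} T dμ = φ(T s)`. The concavity
bound `log s ≤ s / c + log c - 1` for `S'`, with a free constant `c`, bounds the correlation from
below, hence `W₂²(h γ, γ)` from above, through the second moment and the entropy of `h`. The
classical inequality is the choice `c = 1`, and the refined one is the optimal `c` together with
Green's formula `∫ Δh dγ = ∫ h |x|² dγ - n`.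

The refined inequality applied to `h = 1 + ε f`, together with Kantorovich duality for the test
function `ε f`, gives the Poincaré inequality as `ε → 0`. Green's formula also says that `∫ Δf dγ`
is the covariance of `f` and `|x|²`, so the Poincaré inequality for `f - a |x|²` with the best `a`
gains the term `(∫ Δf dγ)² / (2n)`.
-/

noncomputable section

namespace GaussTransport

open Set Filter Topology

section MonotoneTransport

variable {μ ν : Measure ℝ}

lemma continuous_cdf (μ : Measure ℝ) [IsProbabilityMeasure μ] [NullSingletonClass μ] :
    Continuous (cdf μ) := by
  refine continuous_iff_continuousAt.2 fun x => ?_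
  rw [(monotone_cdf μ).continuousAt_iff_leftLim_eq_rightLim, StieltjesFunction.rightLim_eq]
  have hjump : (cdf μ).measure {x} = 0 := by rw [measure_cdf]; exact measure_singleton x
  rw [StieltjesFunction.measure_singleton, ENNReal.ofReal_eq_zero] at hjump
  exact le_antisymm ((monotone_cdf μ).leftLim_le le_rfl) (by linarith)

/-- The quantile function of `ν`, the generalised inverse of its distribution function on `(0, 1)`;
it is extended by the value `0` to the rest of the line. -/
def quantile (ν : Measure ℝ) : ℝ → ℝ :=
  (Ioo 0 1).indicator fun u => sInf {y | u ≤ cdf ν y}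

lemma quantile_le_iff {u y : ℝ} (hu : u ∈ Ioo (0 : ℝ) 1) :
    quantile ν u ≤ y ↔ u ≤ cdf ν y := by
  obtain ⟨b, hb⟩ := ((tendsto_cdf_atTop ν).eventually_const_le hu.2).exists
  obtain ⟨a, ha⟩ := ((tendsto_cdf_atBot ν).eventually_lt_const hu.1).exists
  have hbdd : BddBelow {y | u ≤ cdf ν y} :=
    ⟨a, fun y hy => le_of_not_gt fun hya => (ha.trans_le hy).not_ge (monotone_cdf ν hya.le)⟩
  rw [quantile, indicator_of_mem hu]
  refine ⟨fun h => ?_, fun h => csInf_le hbdd h⟩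
  refine ge_of_tendsto ((cdf ν).right_continuous y |>.mono_left
    (nhdsWithin_mono y Ioi_subset_Ici_self)) ?_
  filter_upwards [self_mem_nhdsWithin] with z hz
  obtain ⟨x, hx, hxz⟩ := exists_lt_of_csInf_lt ⟨b, hb⟩ (h.trans_lt hz)
  exact hx.trans (monotone_cdf ν hxz.le)

lemma measurable_quantile : Measurable (quantile ν) := by
  refine measurable_of_restrict_of_restrict_compl (measurableSet_Ioo (a := 0) (b := 1))
    (measurable_of_Iic fun y => ?_) ?_
  · have : (Ioo 0 1).domRestrict (quantile ν) ⁻¹' Iic y = Subtype.val ⁻¹' Iic (cdf ν y) := by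
      ext u
      exact quantile_le_iff u.2
    rw [this]
    exact measurable_subtype_coe measurableSet_Iic
  · rw [show (Ioo (0 : ℝ) 1)ᶜ.domRestrict (quantile ν) = fun _ => 0 from
      funext fun u => by rw [domRestrict_apply, quantile, indicator_of_notMem u.2]]
    exact measurable_const

lemma map_quantile (ν : Measure ℝ) [IsProbabilityMeasure ν] :
    (volume.restrict (Ioo 0 1)).map (quantile ν) = ν := by
  have : IsFiniteMeasure ((volume.restrict (Ioo (0 : ℝ) 1)).map (quantile ν)) := inferInstance
  refine Measure.ext_of_Iic _ _ fun a => ?_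
  have hpre : quantile ν ⁻¹' Iic a ∩ Ioo 0 1 = Iic (cdf ν a) ∩ Ioo 0 1 :=
    ext fun u => and_congr_left fun hu => quantile_le_iff hu
  rw [Measure.map_apply measurable_quantile measurableSet_Iic,
    Measure.restrict_apply (measurable_quantile measurableSet_Iic), hpre,
    ← Measure.restrict_apply measurableSet_Iic, Measure.restrict_congr_set Ioo_ae_eq_Ioc,
    Measure.restrict_apply measurableSet_Iic, inter_comm, Ioc_inter_Iic, Real.volume_Ioc, sub_zero,
    inf_eq_right.2 (cdf_le_one ν a), ofReal_cdf]

lemma cdf_quantile [IsProbabilityMeasure ν] [NullSingletonClass ν] {u : ℝ}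
    (hu : u ∈ Ioo (0 : ℝ) 1) : cdf ν (quantile ν u) = u := by
  obtain ⟨y, rfl⟩ : u ∈ range (cdf ν) := mem_range_of_exists_le_of_exists_ge (continuous_cdf ν)
    ((tendsto_cdf_atBot ν).eventually_le_const hu.1).exists
    ((tendsto_cdf_atTop ν).eventually_const_le hu.2).exists
  exact le_antisymm (monotone_cdf ν ((quantile_le_iff hu).2 le_rfl))
    ((quantile_le_iff hu).1 le_rfl)

lemma map_cdf (μ : Measure ℝ) [IsProbabilityMeasure μ] [NullSingletonClass μ] :
    μ.map (cdf μ) = volume.restrict (Ioo 0 1) := by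
  conv_lhs => rw [← map_quantile μ]
  rw [Measure.map_map (monotone_cdf _).measurable measurable_quantile]
  conv_rhs => rw [← Measure.map_id (μ := volume.restrict (Ioo (0 : ℝ) 1))]
  refine Measure.map_congr ?_
  filter_upwards [ae_restrict_mem measurableSet_Ioo] with u hu
  rw [map_quantile]
  exact cdf_quantile hu

/-- The distribution function of the normalisation of a finite measure `μ`. -/
def normCDF (μ : Measure ℝ) (x : ℝ) : ℝ := μ.real (Iic x) / μ.real univ

/-- The monotone rearrangement of `μ` into `ν`: it transports the normalisation of an atomless
finite measure `μ` to `ν`. -/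
def monotoneMap (μ ν : Measure ℝ) (x : ℝ) : ℝ := quantile ν (normCDF μ x)

lemma monotone_normCDF [IsFiniteMeasure μ] : Monotone (normCDF μ) := fun _ _ hxy =>
  div_le_div_of_nonneg_right (measureReal_mono (Iic_subset_Iic.2 hxy)) measureReal_nonneg

lemma measurable_monotoneMap [IsFiniteMeasure μ] : Measurable (monotoneMap μ ν) :=
  measurable_quantile.comp monotone_normCDF.measurable

lemma normCDF_smul (μ : Measure ℝ) [IsProbabilityMeasure μ] {m : ℝ≥0∞} (hm : m ≠ 0)
    (hm' : m ≠ ⊤) : normCDF (m • μ) = cdf μ := by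
  ext x
  have : m.toReal ≠ 0 := ENNReal.toReal_ne_zero.2 ⟨hm, hm'⟩
  simp [normCDF, measureReal_ennreal_smul_apply, cdf_eq_real, this]

lemma map_normCDF [IsFiniteMeasure μ] [NullSingletonClass μ] :
    μ.map (normCDF μ) = μ univ • volume.restrict (Ioo 0 1) := by
  rcases eq_zero_or_neZero μ with rfl | hμ
  · simp
  set m := μ univ
  have hm : m ≠ 0 := NeZero.ne _
  have hm' : m ≠ ⊤ := measure_ne_top μ univ
  set μ' := m⁻¹ • μ with hμ'
  have : NullSingletonClass μ' := ⟨fun x => by simp [hμ']⟩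
  have : IsProbabilityMeasure μ' := ⟨by simp [hμ', m]⟩
  have hμm : μ = m • μ' := by rw [hμ', smul_smul, ENNReal.mul_inv_cancel hm hm', one_smul]
  rw [hμm, normCDF_smul μ' hm hm', Measure.map_smul, map_cdf]

lemma ae_normCDF_mem_Ioo [IsFiniteMeasure μ] [NullSingletonClass μ] :
    ∀ᵐ x ∂μ, normCDF μ x ∈ Ioo (0 : ℝ) 1 := by
  refine ae_of_ae_map monotone_normCDF.measurable.aemeasurable ?_
  rw [map_normCDF]
  exact Measure.ae_smul_measure (ae_restrict_mem measurableSet_Ioo) _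

lemma map_monotoneMap [IsFiniteMeasure μ] [NullSingletonClass μ] [IsProbabilityMeasure ν] :
    μ.map (monotoneMap μ ν) = μ univ • ν := by
  rw [show monotoneMap μ ν = quantile ν ∘ normCDF μ from rfl,
    ← Measure.map_map measurable_quantile monotone_normCDF.measurable, map_normCDF,
    Measure.map_smul, map_quantile]

lemma integral_comp_monotoneMap [IsFiniteMeasure μ] [NullSingletonClass μ]
    [IsProbabilityMeasure ν] {f : ℝ → ℝ} (hf : Measurable f) :
    ∫ x, f (monotoneMap μ ν x) ∂μ = μ.real univ * ∫ y, f y ∂ν := by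
  rw [← integral_map measurable_monotoneMap.aemeasurable hf.aestronglyMeasurable,
    map_monotoneMap, integral_smul_measure, smul_eq_mul, measureReal_def]

lemma monotoneMap_preimage_Ioi_ae_eq [IsFiniteMeasure μ] [NullSingletonClass μ]
    [IsProbabilityMeasure ν] [NullSingletonClass ν] {s : ℝ} (hs : normCDF μ s ∈ Ioo (0 : ℝ) 1) :
    monotoneMap μ ν ⁻¹' Ioi (monotoneMap μ ν s) =ᵐ[μ] Ioi s := by
  have hpre : MeasurableSet (monotoneMap μ ν ⁻¹' Ioi (monotoneMap μ ν s)) :=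
    measurable_monotoneMap measurableSet_Ioi
  refine ae_eq_of_ae_subset_of_measure_ge ?_ ?_ hpre.nullMeasurableSet (measure_ne_top _ _)
  · filter_upwards [ae_normCDF_mem_Ioo (μ := μ)] with x hx hxs
    refine lt_of_not_ge fun hle => (mem_Ioi.1 hxs).not_ge ((quantile_le_iff hx).2 ?_)
    exact (monotone_normCDF hle).trans (cdf_quantile hs).ge
  · have hm : μ.real univ ≠ 0 := fun h => by simp [normCDF, h] at hs
    rw [← Measure.map_apply measurable_monotoneMap measurableSet_Ioi, map_monotoneMap,
      Measure.smul_apply, smul_eq_mul, ← ENNReal.toReal_le_toReal (measure_ne_top _ _)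
      (by finiteness), ENNReal.toReal_mul, ← measureReal_def, ← measureReal_def, ← measureReal_def,
      ← compl_Iic, ← compl_Iic, measureReal_compl measurableSet_Iic,
      measureReal_compl measurableSet_Iic, probReal_univ (μ := ν), ← cdf_eq_real ν, monotoneMap,
      cdf_quantile hs, normCDF]
    exact (by field_simp : _ = _).le

lemma setIntegral_Ioi_monotoneMap [IsFiniteMeasure μ] [NullSingletonClass μ]
    [IsProbabilityMeasure ν] [NullSingletonClass ν] {s : ℝ} (hs : normCDF μ s ∈ Ioo (0 : ℝ) 1) :
    ∫ x in Ioi s, monotoneMap μ ν x ∂μ = μ.real univ * ∫ y in Ioi (monotoneMap μ ν s), y ∂ν := by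
  rw [← setIntegral_congr_set (monotoneMap_preimage_Ioi_ae_eq (ν := ν) hs),
    ← setIntegral_map (f := fun y => y) measurableSet_Ioi (by fun_prop)
      measurable_monotoneMap.aemeasurable, map_monotoneMap, Measure.restrict_smul,
    integral_smul_measure, smul_eq_mul, measureReal_def]

end MonotoneTransport

section LayerCake

lemma indicator_Iio_sub_indicator_Iio_zero (x s : ℝ) :
    ((Iio x).indicator 1 s - (Iio 0).indicator 1 s : ℝ) =
      (Ico 0 x).indicator 1 s - (Ico x 0).indicator 1 s := by
  simp only [indicator_apply, mem_Iio, mem_Ico, Pi.one_apply]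
  grind

lemma integral_indicator_Iio_sub (x : ℝ) :
    ∫ s, ((Iio x).indicator 1 s - (Iio 0).indicator 1 s : ℝ) = x := by
  have hint : ∀ a b : ℝ, Integrable ((Ico a b).indicator (1 : ℝ → ℝ)) := fun a b =>
    (integrable_indicator_iff measurableSet_Ico).2 (integrableOn_const (by simp))
  simp_rw [indicator_Iio_sub_indicator_Iio_zero]
  rw [integral_sub (hint 0 x) (hint x 0), integral_indicator_one measurableSet_Ico,
    integral_indicator_one measurableSet_Ico, Real.volume_real_Ico, Real.volume_real_Ico]
  grind

lemma lintegral_enorm_indicator_Iio_sub (x : ℝ) :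
    ∫⁻ s, ‖((Iio x).indicator 1 s - (Iio 0).indicator 1 s : ℝ)‖ₑ = ‖x‖ₑ := by
  have henorm : ∀ s : ℝ, ‖((Iio x).indicator 1 s - (Iio 0).indicator 1 s : ℝ)‖ₑ =
      (Ico (min x 0) (max x 0)).indicator 1 s := by
    intro s
    simp only [indicator_apply, mem_Iio, mem_Ico, Pi.one_apply, min_le_iff, lt_max_iff]
    by_cases hx : s < x <;> by_cases h0 : s < 0 <;> simp [hx, h0, le_of_not_gt]
  simp_rw [henorm]
  rw [lintegral_indicator_one measurableSet_Ico, Real.volume_Ico, max_sub_min_eq_abs', sub_zero,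
    Real.enorm_eq_ofReal_abs]

variable {μ : Measure ℝ} {f : ℝ → ℝ}

lemma integrable_mul_indicator_Iio_sub (hf : Integrable f μ)
    (hxf : Integrable (fun x => x * f x) μ) :
    Integrable (fun p : ℝ × ℝ => f p.1 * ((Iio p.1).indicator 1 p.2 - (Iio 0).indicator 1 p.2))
      (μ.prod volume) := by
  have hind : Measurable fun p : ℝ × ℝ => ((Iio p.1).indicator 1 p.2 : ℝ) :=
    (measurable_one.indicator (measurableSet_lt measurable_snd measurable_fst) :
      Measurable ({p : ℝ × ℝ | p.2 < p.1}.indicator (1 : ℝ × ℝ → ℝ)))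
  have hmeas : Measurable fun p : ℝ × ℝ =>
      ((Iio p.1).indicator 1 p.2 - (Iio 0).indicator 1 p.2 : ℝ) :=
    hind.sub ((measurable_one.indicator measurableSet_Iio).comp measurable_snd)
  have hae : AEStronglyMeasurable (fun p : ℝ × ℝ =>
      f p.1 * ((Iio p.1).indicator 1 p.2 - (Iio 0).indicator 1 p.2)) (μ.prod volume) :=
    hf.1.comp_fst.mul hmeas.aestronglyMeasurable
  refine ⟨hae, ?_⟩
  rw [hasFiniteIntegral_iff_enorm, lintegral_prod _ hae.enorm]
  have hslice : ∀ x, ∫⁻ s, ‖f x * ((Iio x).indicator 1 s - (Iio 0).indicator 1 s)‖ₑ =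
      ‖x * f x‖ₑ := fun x => by
    simp_rw [enorm_mul]
    rw [lintegral_const_mul' _ _ enorm_ne_top, lintegral_enorm_indicator_Iio_sub, mul_comm]
  simp_rw [hslice]
  exact hxf.2

lemma integral_mul_indicator_Iio_sub (hf : Integrable f μ) (hf0 : ∫ x, f x ∂μ = 0) (s : ℝ) :
    ∫ x, f x * ((Iio x).indicator 1 s - (Iio 0).indicator 1 s) ∂μ = ∫ x in Ioi s, f x ∂μ := by
  have hslice : ∀ x, f x * ((Iio x).indicator 1 s - (Iio 0).indicator 1 s) =
      (Ioi s).indicator f x - f x * (Iio 0).indicator 1 s := fun x => by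
    by_cases h : s < x <;> simp [h, mul_sub]
  simp_rw [hslice]
  rw [integral_sub (hf.indicator measurableSet_Ioi) (hf.mul_const _), integral_mul_const, hf0,
    integral_indicator measurableSet_Ioi, zero_mul, sub_zero]

variable [SFinite μ]

lemma integrable_setIntegral_Ioi (hf : Integrable f μ) (hxf : Integrable (fun x => x * f x) μ)
    (hf0 : ∫ x, f x ∂μ = 0) : Integrable fun s => ∫ x in Ioi s, f x ∂μ := by
  simpa only [integral_mul_indicator_Iio_sub hf hf0] using
    (integrable_mul_indicator_Iio_sub hf hxf).integral_prod_right

lemma integral_setIntegral_Ioi (hf : Integrable f μ) (hxf : Integrable (fun x => x * f x) μ)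
    (hf0 : ∫ x, f x ∂μ = 0) : ∫ s, ∫ x in Ioi s, f x ∂μ = ∫ x, x * f x ∂μ := by
  simp_rw [← integral_mul_indicator_Iio_sub hf hf0]
  rw [← integral_integral_swap (integrable_mul_indicator_Iio_sub hf hxf)]
  simp_rw [integral_const_mul, integral_indicator_Iio_sub, mul_comm]

end LayerCake

section GaussLine

/-- The standard Gaussian measure on the line. -/
abbrev gaussLine : Measure ℝ := gaussianReal 0 1

instance : NullSingletonClass gaussLine := nullSingletonClass_gaussianReal one_ne_zero

lemma integrable_id_gaussLine : Integrable id gaussLine :=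
  (memLp_id_gaussianReal 1).integrable le_rfl

lemma memLp_id_gaussLine : MemLp id 2 gaussLine := memLp_id_gaussianReal 2

lemma integral_sq_gaussLine : ∫ x, x ^ 2 ∂gaussLine = 1 := by
  have hvar := variance_fun_id_gaussianReal (μ := 0) (v := 1)
  rw [variance_eq_integral (by fun_prop)] at hvar
  simpa using hvar

lemma hasDerivAt_gaussianPDFReal (x : ℝ) :
    HasDerivAt (gaussianPDFReal 0 1) (-(x * gaussianPDFReal 0 1 x)) x := by
  have hexp : HasDerivAt (fun x : ℝ => -(x - 0) ^ 2 / (2 * ((1 : NNReal) : ℝ))) (-x) x := by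
    refine (((hasDerivAt_id x).sub_const 0).pow 2).neg.div_const _ |>.congr_deriv ?_
    simp only [id_eq, NNReal.coe_one]
    ring
  refine (hexp.exp.const_mul _).congr_deriv ?_
  simp only [gaussianPDFReal]
  ring

lemma tendsto_gaussianPDFReal_atTop : Tendsto (gaussianPDFReal 0 1) atTop (𝓝 0) := by
  have hexp : Tendsto (fun x : ℝ => -(x - 0) ^ 2 / (2 * ((1 : NNReal) : ℝ))) atTop atBot := by
    simp only [sub_zero, NNReal.coe_one, mul_one, neg_div]
    exact tendsto_neg_atTop_atBot.comp ((tendsto_pow_atTop two_ne_zero).atTop_div_const two_pos)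
  rw [gaussianPDFReal_def]
  simpa only [mul_zero, Function.comp_def] using (Real.tendsto_exp_atBot.comp hexp).const_mul _

lemma integrable_gaussLine_iff {f : ℝ → ℝ} :
    Integrable f gaussLine ↔ Integrable fun x => gaussianPDFReal 0 1 x * f x := by
  rw [gaussLine, gaussianReal_of_var_ne_zero 0 one_ne_zero,
    integrable_withDensity_iff_integrable_smul' (measurable_gaussianPDF 0 1)
      (by simp [gaussianPDF])]
  simp only [toReal_gaussianPDF, smul_eq_mul]

lemma integral_gaussLine (f : ℝ → ℝ) :
    ∫ x, f x ∂gaussLine = ∫ x, gaussianPDFReal 0 1 x * f x := by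
  simp_rw [gaussLine, integral_gaussianReal_eq_integral_smul one_ne_zero, smul_eq_mul]

lemma setIntegral_Ioi_gaussLine (a : ℝ) :
    ∫ y in Ioi a, y ∂gaussLine = gaussianPDFReal 0 1 a := by
  have hderiv := integral_Ioi_of_hasDerivAt_of_tendsto' (a := a) (m := -0)
    (fun x _ => (hasDerivAt_gaussianPDFReal x).neg)
    (by simpa [mul_comm] using (integrable_gaussLine_iff.1 integrable_id_gaussLine).integrableOn)
    tendsto_gaussianPDFReal_atTop.neg
  rw [← integral_indicator measurableSet_Ioi, integral_gaussLine]
  simp_rw [← indicator_mul_right (Ioi a) (gaussianPDFReal 0 1)]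
  rw [integral_indicator measurableSet_Ioi]
  simpa [mul_comm] using hderiv

lemma log_gaussianPDFReal (x : ℝ) :
    Real.log (gaussianPDFReal 0 1 x) = -Real.log (√(2 * Real.pi)) - x ^ 2 / 2 := by
  rw [gaussianPDFReal, Real.log_mul (by positivity) (Real.exp_ne_zero _), Real.log_exp,
    Real.log_inv, NNReal.coe_one, mul_one]
  ring_nf

end GaussLine

section Density

variable {E : Type*} [MeasurableSpace E] {ν : Measure E} {h : E → ℝ}

lemma lintegral_densMeasure (hm : Measurable h) {f : E → ℝ≥0∞} (hf : Measurable f) :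
    ∫⁻ x, f x ∂densMeasure ν h = ∫⁻ x, ENNReal.ofReal (h x) * f x ∂ν := by
  rw [densMeasure, lintegral_withDensity_eq_lintegral_mul _ hm.ennreal_ofReal hf]
  rfl

lemma integral_densMeasure (hm : Measurable h) (h0 : ∀ x, 0 ≤ h x) (f : E → ℝ) :
    ∫ x, f x ∂densMeasure ν h = ∫ x, h x * f x ∂ν := by
  rw [densMeasure, integral_withDensity_eq_integral_toReal_smul hm.ennreal_ofReal (by simp)]
  simp_rw [ENNReal.toReal_ofReal (h0 _), smul_eq_mul]

lemma integrable_densMeasure_iff (hm : Measurable h) (h0 : ∀ x, 0 ≤ h x) {f : E → ℝ} :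
    Integrable f (densMeasure ν h) ↔ Integrable (fun x => h x * f x) ν := by
  rw [densMeasure, integrable_withDensity_iff hm.ennreal_ofReal (by simp)]
  simp_rw [ENNReal.toReal_ofReal (h0 _), mul_comm]

lemma densMeasure_univ (h0 : ∀ x, 0 ≤ h x) (hh : Integrable h ν) :
    densMeasure ν h univ = ENNReal.ofReal (∫ x, h x ∂ν) := by
  rw [densMeasure, withDensity_apply _ MeasurableSet.univ, Measure.restrict_univ,
    ofReal_integral_eq_lintegral_ofReal hh (.of_forall h0)]

lemma isFiniteMeasure_densMeasure (h0 : ∀ x, 0 ≤ h x) (hh : Integrable h ν) :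
    IsFiniteMeasure (densMeasure ν h) :=
  ⟨by simp [densMeasure_univ h0 hh]⟩

lemma measureReal_univ_densMeasure (h0 : ∀ x, 0 ≤ h x) (hh : Integrable h ν) :
    (densMeasure ν h).real univ = ∫ x, h x ∂ν := by
  rw [measureReal_def, densMeasure_univ h0 hh, ENNReal.toReal_ofReal (integral_nonneg h0)]

instance [NullSingletonClass ν] : NullSingletonClass (densMeasure ν h) :=
  inferInstanceAs (NullSingletonClass (ν.withDensity _))

lemma ae_of_ae_densMeasure (hm : Measurable h) {p : E → Prop} (hp : ∀ᵐ x ∂densMeasure ν h, p x) :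
    ∀ᵐ x ∂ν, 0 < h x → p x := by
  filter_upwards [(ae_withDensity_iff hm.ennreal_ofReal).1 hp] with x hx hpos
  exact hx (by simpa using hpos)

lemma IsProbDensity.integrable (hh : IsProbDensity ν h) : Integrable h ν :=
  not_imp_comm.1 integral_undef (by simp [hh.2.2])

lemma IsProbDensity.isProbabilityMeasure (hh : IsProbDensity ν h) :
    IsProbabilityMeasure (densMeasure ν h) :=
  ⟨by rw [densMeasure_univ hh.2.1 hh.integrable, hh.2.2, ENNReal.ofReal_one]⟩

end Density

section LineCorrelation

lemma mul_one_sub_log_add_log_sub_log_le {v w c : ℝ} (hv : 0 < v) (hw : 0 < w) (hc : 0 < c) :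
    c * w * (1 - Real.log c + Real.log v - Real.log w) ≤ v := by
  have hlog := Real.log_le_sub_one_of_pos (x := v / (c * w)) (by positivity)
  rw [Real.log_div hv.ne' (by positivity), Real.log_mul hc.ne' hw.ne'] at hlog
  have hle : 1 - Real.log c + Real.log v - Real.log w ≤ v / (c * w) := by linarith
  rwa [le_div_iff₀ (by positivity), mul_comm] at hle

variable {μ : Measure ℝ} [IsFiniteMeasure μ] [NullSingletonClass μ]

lemma setIntegral_Ioi_monotoneMap_gaussLine {s : ℝ} (hs : normCDF μ s ∈ Ioo (0 : ℝ) 1) :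
    ∫ x in Ioi s, monotoneMap μ gaussLine x ∂μ =
      μ.real univ * gaussianPDFReal 0 1 (monotoneMap μ gaussLine s) := by
  rw [setIntegral_Ioi_monotoneMap hs, setIntegral_Ioi_gaussLine]

lemma integral_monotoneMap_gaussLine : ∫ x, monotoneMap μ gaussLine x ∂μ = 0 := by
  rw [integral_comp_monotoneMap (f := fun y => y) measurable_id, integral_id_gaussianReal, mul_zero]

lemma setIntegral_Ioi_monotoneMap_gaussLine_nonneg (s : ℝ) :
    0 ≤ ∫ x in Ioi s, monotoneMap μ gaussLine x ∂μ := by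
  by_cases hs : normCDF μ s ∈ Ioo (0 : ℝ) 1
  · rw [setIntegral_Ioi_monotoneMap_gaussLine hs]
    exact mul_nonneg measureReal_nonneg (gaussianPDFReal_nonneg _ _ _)
  have hcompl := measureReal_compl (μ := μ) (measurableSet_Iic (a := s))
  rw [compl_Iic] at hcompl
  have hle : μ.real (Iic s) ≤ μ.real univ := measureReal_mono (subset_univ _)
  rcases (measureReal_nonneg : 0 ≤ μ.real (Iic s)).eq_or_lt with h0 | h0
  · have hae : Ioi s =ᵐ[μ] univ := by
      rw [ae_eq_univ, compl_Ioi]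
      exact (measureReal_eq_zero_iff).1 h0.symm
    rw [setIntegral_congr_set hae, setIntegral_univ, integral_monotoneMap_gaussLine]
  · have heq : μ.real (Iic s) = μ.real univ := hle.antisymm <| not_lt.1 fun hlt =>
      hs ⟨div_pos h0 (h0.trans hlt), (div_lt_one (h0.trans hlt)).2 hlt⟩
    have hzero : μ.real (Ioi s) = 0 := by rw [hcompl, heq, sub_self]
    rw [setIntegral_measure_zero _ ((measureReal_eq_zero_iff).1 hzero)]

lemma le_setIntegral_Ioi_monotoneMap_gaussLine {s w c : ℝ} (hw : 0 ≤ w) (hc : 0 < c)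
    (hs : 0 < w → normCDF μ s ∈ Ioo (0 : ℝ) 1) :
    gaussianPDFReal 0 1 s * (c * (w * (1 - Real.log c + Real.log (μ.real univ)) +
      w * s ^ 2 / 2 - w * monotoneMap μ gaussLine s ^ 2 / 2 - w * Real.log w)) ≤
    ∫ x in Ioi s, monotoneMap μ gaussLine x ∂μ := by
  rcases hw.eq_or_lt with rfl | hw
  · simpa using setIntegral_Ioi_monotoneMap_gaussLine_nonneg s
  have hm : 0 < μ.real univ :=
    measureReal_nonneg.lt_of_ne fun h => by simpa [normCDF, ← h] using hs hw
  have hpdf : ∀ x, 0 < gaussianPDFReal 0 1 x := fun x => gaussianPDFReal_pos 0 1 x one_ne_zero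
  rw [setIntegral_Ioi_monotoneMap_gaussLine (hs hw)]
  refine le_trans (le_of_eq ?_)
    (mul_one_sub_log_add_log_sub_log_le (mul_pos hm (hpdf _)) (mul_pos (hpdf s) hw) hc)
  rw [Real.log_mul hm.ne' (hpdf _).ne', Real.log_mul (hpdf _).ne' hw.ne', log_gaussianPDFReal,
    log_gaussianPDFReal]
  ring

lemma le_integral_mul_monotoneMap_gaussLine {k : ℝ → ℝ} (hkm : Measurable k) (hk0 : ∀ t, 0 ≤ k t)
    (hk : Integrable k gaussLine) (hmom : Integrable (fun t => k t * t ^ 2) gaussLine)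
    (hent : Integrable (fun t => k t * Real.log (k t)) gaussLine) {c : ℝ} (hc : 0 < c) :
    c * ((∫ t, k t ∂gaussLine) * (1 / 2 - Real.log c) +
        (∫ t, k t ∂gaussLine) * Real.log (∫ t, k t ∂gaussLine) +
        1 / 2 * (∫ t, k t * t ^ 2 ∂gaussLine) - ∫ t, k t * Real.log (k t) ∂gaussLine) ≤
      ∫ t, k t * (t * monotoneMap (densMeasure gaussLine k) gaussLine t) ∂gaussLine := by
  set μ := densMeasure gaussLine k
  set T := monotoneMap μ gaussLine
  have : IsFiniteMeasure μ := isFiniteMeasure_densMeasure hk0 hk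
  have hμ : μ.real univ = ∫ t, k t ∂gaussLine := measureReal_univ_densMeasure hk0 hk
  have hT2 : MemLp T 2 μ := by
    have := memLp_id_gaussLine.smul_measure (measure_ne_top μ univ)
    rw [← map_monotoneMap (ν := gaussLine)] at this
    exact this.comp_of_map measurable_monotoneMap.aemeasurable
  have hkT2 : Integrable (fun t => k t * T t ^ 2) gaussLine :=
    (integrable_densMeasure_iff hkm hk0).1 hT2.integrable_sq
  have hid2 : MemLp id 2 μ := (memLp_two_iff_integrable_sq (by fun_prop)).2
    ((integrable_densMeasure_iff hkm hk0).2 hmom)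
  have hT : Integrable T μ := hT2.integrable one_le_two
  have hxT : Integrable (fun x => x * T x) μ := hid2.integrable_mul hT2
  have hlin := hk.mul_const (1 - Real.log c + Real.log (μ.real univ))
  have hintT2 : ∫ t, k t * T t ^ 2 ∂gaussLine = ∫ t, k t ∂gaussLine := by
    rw [← integral_densMeasure hkm hk0, integral_comp_monotoneMap (f := fun y => y ^ 2)
      (by fun_prop), integral_sq_gaussLine, mul_one, hμ]
  calc _ = ∫ s, c * (k s * (1 - Real.log c + Real.log (μ.real univ)) +
        k s * s ^ 2 / 2 - k s * T s ^ 2 / 2 - k s * Real.log (k s)) ∂gaussLine := by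
        rw [integral_const_mul, integral_sub (by fun_prop) hent, integral_sub (by fun_prop)
          (by fun_prop), integral_add hlin (by fun_prop), integral_mul_const, integral_div,
          integral_div, hintT2, hμ]
        ring
    _ = _ := integral_gaussLine _
    _ ≤ ∫ s, ∫ t in Ioi s, T t ∂μ := by
        refine integral_mono_ae (integrable_gaussLine_iff.1 (by fun_prop))
          (integrable_setIntegral_Ioi hT hxT integral_monotoneMap_gaussLine) ?_
        filter_upwards [(gaussianReal_absolutelyContinuous' 0 one_ne_zero).ae_le
          (ae_of_ae_densMeasure hkm ae_normCDF_mem_Ioo)] with s hs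
        exact le_setIntegral_Ioi_monotoneMap_gaussLine (hk0 s) hc hs
    _ = _ := by
        rw [integral_setIntegral_Ioi hT hxT integral_monotoneMap_gaussLine,
          integral_densMeasure hkm hk0]

end LineCorrelation

section Entropy

variable {E : Type*} [MeasurableSpace E] {ν : Measure E} {h b : E → ℝ}

lemma neg_one_le_mul_log {u : ℝ} (hu : 0 ≤ u) : -1 ≤ u * Real.log u := by
  rcases hu.eq_or_lt with rfl | hu
  · simp
  have hlog := mul_le_mul_of_nonneg_left (Real.one_sub_inv_le_log_of_pos hu) hu.le
  rw [mul_sub, mul_inv_cancel₀ hu.ne'] at hlog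
  linarith

lemma integral_mul_log_integral_le [IsProbabilityMeasure ν] (h0 : ∀ x, 0 ≤ h x)
    (hi : Integrable h ν) (hent : Integrable (fun x => h x * Real.log (h x)) ν) :
    (∫ x, h x ∂ν) * Real.log (∫ x, h x ∂ν) ≤ ∫ x, h x * Real.log (h x) ∂ν :=
  Real.convexOn_mul_log.map_integral_le Real.continuous_mul_log.continuousOn isClosed_Ici
    (.of_forall h0) hi hent

lemma mul_le_mul_log_add_exp {a b : ℝ} (ha : 0 ≤ a) : a * b ≤ a * Real.log a - a + Real.exp b := by
  rcases ha.eq_or_lt with rfl | ha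
  · simpa using (Real.exp_pos b).le
  have hexp := Real.add_one_le_exp (b - Real.log a)
  rw [Real.exp_sub, Real.exp_log ha, le_div_iff₀ ha] at hexp
  linarith

lemma integrable_mul_of_integrable_exp (hm : Measurable h) (h0 : ∀ x, 0 ≤ h x)
    (hi : Integrable h ν) (hent : Integrable (fun x => h x * Real.log (h x)) ν)
    (hb : Measurable b) (hb0 : ∀ x, 0 ≤ b x) (hexp : Integrable (fun x => Real.exp (b x)) ν) :
    Integrable (fun x => h x * b x) ν := by
  refine ((hent.sub hi).add hexp).mono' (hm.mul hb).aestronglyMeasurable (.of_forall fun x => ?_)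
  rw [Real.norm_of_nonneg (mul_nonneg (h0 x) (hb0 x))]
  exact mul_le_mul_log_add_exp (h0 x)

lemma integrable_exp_sq_gaussLine : Integrable (fun t : ℝ => Real.exp (t ^ 2 / 4)) gaussLine := by
  refine integrable_gaussLine_iff.2 (((integrable_exp_neg_mul_sq (b := 1 / 4)
    (by norm_num)).const_mul (√(2 * Real.pi))⁻¹).congr (.of_forall fun t => ?_))
  simp only [gaussianPDFReal, sub_zero, NNReal.coe_one, mul_one]
  rw [mul_assoc, ← Real.exp_add]
  ring_nf

end Entropy

section ConditionalTransport

variable {E : Type*} [MeasurableSpace E] {ν : Measure E} {h : ℝ × E → ℝ}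

/-- The marginal density on the second factor of a density `h` with respect to the product of
`gaussLine` and a measure on `E`. -/
def marginal (h : ℝ × E → ℝ) (x : E) : ℝ := ∫ t, h (t, x) ∂gaussLine

/-- The triangular transport of a density `h` with respect to the product of `gaussLine` and a
measure on `E`: the monotone rearrangement of the first coordinate into a standard Gaussian,
conditionally on the second one. -/
def condTransport (h : ℝ × E → ℝ) (p : ℝ × E) : ℝ :=
  monotoneMap (densMeasure gaussLine fun s => h (s, p.2)) gaussLine p.1

lemma measurable_marginal (hm : Measurable h) : Measurable (marginal h) :=
  (hm.stronglyMeasurable.integral_prod_left' (μ := gaussLine)).measurable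

lemma measurable_condTransport (hm : Measurable h) : Measurable (condTransport h) := by
  have hIic : Measurable fun p : ℝ × E =>
      densMeasure gaussLine (fun s => h (s, p.2)) (Iic p.1) := by
    simp_rw [densMeasure, withDensity_apply _ measurableSet_Iic,
      ← lintegral_indicator measurableSet_Iic]
    refine Measurable.lintegral_prod_left' (f := fun q : ℝ × ℝ × E =>
      {q : ℝ × ℝ × E | q.1 ≤ q.2.1}.indicator (fun q => ENNReal.ofReal (h (q.1, q.2.2))) q) ?_
    exact (hm.comp (by fun_prop)).ennreal_ofReal.indicator
      (measurableSet_le (by fun_prop) (by fun_prop))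
  have huniv : Measurable fun p : ℝ × E => densMeasure gaussLine (fun s => h (s, p.2)) univ := by
    simp_rw [densMeasure, withDensity_apply _ MeasurableSet.univ, Measure.restrict_univ]
    exact (hm.ennreal_ofReal.lintegral_prod_left' (μ := gaussLine)).comp measurable_snd
  exact measurable_quantile.comp (hIic.ennreal_toReal.div huniv.ennreal_toReal)

lemma integrable_mul_fst_sq [IsFiniteMeasure ν] (hh : IsProbDensity (gaussLine.prod ν) h)
    (hent : Integrable (fun p => h p * Real.log (h p)) (gaussLine.prod ν)) :
    Integrable (fun p => h p * p.1 ^ 2) (gaussLine.prod ν) := by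
  have := integrable_mul_of_integrable_exp hh.1 hh.2.1 hh.integrable hent
    (b := fun p => p.1 ^ 2 / 4) (by fun_prop) (fun p => by positivity)
    (integrable_exp_sq_gaussLine.comp_fst ν)
  exact (this.const_mul 4).congr (.of_forall fun p => by ring)

lemma isProbDensity_marginal [SFinite ν] (hh : IsProbDensity (gaussLine.prod ν) h) :
    IsProbDensity ν (marginal h) := by
  refine ⟨measurable_marginal hh.1, fun x => integral_nonneg fun t => hh.2.1 _, ?_⟩
  rw [← hh.2.2, integral_prod_symm _ hh.integrable]
  rfl

lemma measurePreserving_condTransport_prodMk [SFinite ν]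
    (hh : IsProbDensity (gaussLine.prod ν) h) :
    MeasurePreserving (fun p => (condTransport h p, p.2)) (densMeasure (gaussLine.prod ν) h)
      (gaussLine.prod (densMeasure ν (marginal h))) := by
  have hm := hh.1
  have hT := (measurable_condTransport hm).prodMk measurable_snd
  have hmarg := isProbDensity_marginal hh
  have := hmarg.isProbabilityMeasure
  refine ⟨hT, Measure.ext_of_lintegral _ fun f hf => ?_⟩
  have hf' : Measurable fun p => f (condTransport h p, p.2) := hf.comp hT
  rw [lintegral_map hf hT, lintegral_densMeasure hm hf',
    lintegral_prod_symm _ (by fun_prop),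
    lintegral_prod_symm _ hf.aemeasurable,
    lintegral_densMeasure hmarg.1 (Measurable.lintegral_prod_left' hf)]
  refine lintegral_congr_ae ?_
  filter_upwards [hh.integrable.prod_left_ae] with x hx
  have h0x : ∀ t, 0 ≤ h (t, x) := fun t => hh.2.1 _
  have := isFiniteMeasure_densMeasure h0x hx
  have hfx : Measurable fun t => f (t, x) := by fun_prop
  calc _ = ∫⁻ t, f (monotoneMap (densMeasure gaussLine fun s => h (s, x)) gaussLine t, x)
          ∂densMeasure gaussLine fun s => h (s, x) :=
        (lintegral_densMeasure (by fun_prop) (hfx.comp measurable_monotoneMap)).symm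
    _ = _ := by
        rw [← lintegral_map hfx measurable_monotoneMap, map_monotoneMap, lintegral_smul_measure,
          densMeasure_univ h0x hx]
        rfl

lemma measurePreserving_condTransport [SFinite ν] (hh : IsProbDensity (gaussLine.prod ν) h) :
    MeasurePreserving (condTransport h) (densMeasure (gaussLine.prod ν) h) gaussLine :=
  have := (isProbDensity_marginal hh).isProbabilityMeasure
  measurePreserving_fst.comp (measurePreserving_condTransport_prodMk hh)

lemma measurePreserving_snd_densMeasure [SFinite ν] (hh : IsProbDensity (gaussLine.prod ν) h) :
    MeasurePreserving Prod.snd (densMeasure (gaussLine.prod ν) h) (densMeasure ν (marginal h)) :=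
  have := (isProbDensity_marginal hh).isProbabilityMeasure
  ((measurePreserving_snd (μ := gaussLine) (ν := densMeasure ν (marginal h))).comp
    (measurePreserving_condTransport_prodMk hh) :)

lemma integral_mul_comp_snd [SFinite ν] (hh : IsProbDensity (gaussLine.prod ν) h) {g : E → ℝ}
    (hg : Measurable g) :
    ∫ p, h p * g p.2 ∂gaussLine.prod ν = ∫ x, marginal h x * g x ∂ν := by
  have hmarg := isProbDensity_marginal hh
  rw [← integral_densMeasure hmarg.1 hmarg.2.1, ← (measurePreserving_snd_densMeasure hh).map_eq,
    integral_map measurable_snd.aemeasurable hg.aestronglyMeasurable,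
    integral_densMeasure hh.1 hh.2.1]

lemma integrable_mul_condTransport [SFinite ν] (hh : IsProbDensity (gaussLine.prod ν) h)
    (hmom : Integrable (fun p => h p * p.1 ^ 2) (gaussLine.prod ν)) :
    Integrable (fun p => h p * (p.1 * condTransport h p)) (gaussLine.prod ν) := by
  rw [← integrable_densMeasure_iff hh.1 hh.2.1] at hmom ⊢
  have hfst : MemLp Prod.fst 2 (densMeasure (gaussLine.prod ν) h) :=
    (memLp_two_iff_integrable_sq (by fun_prop)).2 hmom
  exact hfst.integrable_mul
    (memLp_id_gaussLine.comp_measurePreserving (measurePreserving_condTransport hh))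

lemma integrable_marginal_mul_log [IsProbabilityMeasure ν]
    (hh : IsProbDensity (gaussLine.prod ν) h)
    (hent : Integrable (fun p => h p * Real.log (h p)) (gaussLine.prod ν)) :
    Integrable (fun x => marginal h x * Real.log (marginal h x)) ν := by
  have hmarg := isProbDensity_marginal hh
  refine (hent.integral_prod_right.abs.add (integrable_const 1)).mono'
    (hmarg.1.mul hmarg.1.log).aestronglyMeasurable ?_
  filter_upwards [hh.integrable.prod_left_ae, hent.prod_left_ae] with x hx hx'
  have hjensen : marginal h x * Real.log (marginal h x) ≤ _ :=
    integral_mul_log_integral_le (fun t => hh.2.1 (t, x)) hx hx'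
  have hlower := neg_one_le_mul_log (hmarg.2.1 x)
  rw [Real.norm_eq_abs, abs_le, Pi.add_apply]
  constructor <;> linarith [le_abs_self (∫ t, h (t, x) * Real.log (h (t, x)) ∂gaussLine),
    abs_nonneg (∫ t, h (t, x) * Real.log (h (t, x)) ∂gaussLine)]

lemma le_integral_mul_condTransport [IsProbabilityMeasure ν]
    (hh : IsProbDensity (gaussLine.prod ν) h)
    (hent : Integrable (fun p => h p * Real.log (h p)) (gaussLine.prod ν)) {c : ℝ} (hc : 0 < c) :
    c * (1 / 2 - Real.log c + ∫ x, marginal h x * Real.log (marginal h x) ∂ν +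
        1 / 2 * (∫ p, h p * p.1 ^ 2 ∂gaussLine.prod ν) -
        ∫ p, h p * Real.log (h p) ∂gaussLine.prod ν) ≤
      ∫ p, h p * (p.1 * condTransport h p) ∂gaussLine.prod ν := by
  have hmom := integrable_mul_fst_sq hh hent
  have hmarg := isProbDensity_marginal hh
  have hcorr := integrable_mul_condTransport hh hmom
  have hmass := hmarg.integrable.mul_const (1 / 2 - Real.log c)
  have hml := integrable_marginal_mul_log hh hent
  have hmom' := hmom.integral_prod_right.const_mul (1 / 2)
  have hent' := hent.integral_prod_right
  calc _ = ∫ x, c * (marginal h x * (1 / 2 - Real.log c) + marginal h x * Real.log (marginal h x) +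
        1 / 2 * (∫ t, h (t, x) * t ^ 2 ∂gaussLine) -
        ∫ t, h (t, x) * Real.log (h (t, x)) ∂gaussLine) ∂ν := by
        rw [integral_const_mul, integral_sub (by fun_prop) hent', integral_add (by fun_prop) hmom',
          integral_add hmass hml, integral_mul_const,
          integral_const_mul, hmarg.2.2, one_mul, integral_prod_symm _ hmom,
          integral_prod_symm _ hent]
    _ ≤ ∫ x, ∫ t, h (t, x) * (t * condTransport h (t, x)) ∂gaussLine ∂ν := by
        refine integral_mono_ae ((((hmass.add hml).add hmom').sub hent').const_mul c)
          hcorr.integral_prod_right ?_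
        filter_upwards [hh.integrable.prod_left_ae, hent.prod_left_ae, hmom.prod_left_ae]
          with x hx hentx hmomx
        exact le_integral_mul_monotoneMap_gaussLine (hh.1.comp (by fun_prop))
          (fun t => hh.2.1 _) hx hmomx hentx hc
    _ = _ := (integral_prod_symm _ hcorr).symm

end ConditionalTransport

section GaussianCoordinates

variable {n : ℕ}

lemma measurePreserving_ofLp_gauss :
    MeasurePreserving (MeasurableEquiv.toLp 2 (Fin n → ℝ)).symm (gauss n)
      (Measure.pi fun _ => gaussLine) :=
  MeasurePreserving.symm (MeasurableEquiv.toLp 2 (Fin n → ℝ))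
    ⟨(MeasurableEquiv.toLp 2 _).measurable, map_pi_eq_stdGaussian⟩

lemma measurePreserving_coord_gauss (i : Fin n) :
    MeasurePreserving (fun x : EuclideanSpace ℝ (Fin n) => x i) (gauss n) gaussLine :=
  (measurePreserving_eval (fun _ : Fin n => gaussLine) i).comp measurePreserving_ofLp_gauss

lemma memLp_coord_gauss (i : Fin n) (p : ℝ≥0∞) (hp : p ≠ ⊤) :
    MemLp (fun x : EuclideanSpace ℝ (Fin n) => x i) p (gauss n) :=
  (IsGaussian.memLp_id gaussLine p hp).comp_measurePreserving (measurePreserving_coord_gauss i)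

lemma integrable_norm_sq_gauss :
    Integrable (fun x : EuclideanSpace ℝ (Fin n) => ‖x‖ ^ 2) (gauss n) :=
  (IsGaussian.memLp_two_id (μ := gauss n)).integrable_norm_pow two_ne_zero

lemma integral_norm_sq_gauss : ∫ x, ‖x‖ ^ 2 ∂gauss n = n := by
  simp_rw [EuclideanSpace.real_norm_sq_eq]
  rw [integral_finsetSum _ fun i _ => (memLp_coord_gauss i 2 (by simp)).integrable_sq]
  have hcoord : ∀ i : Fin n, ∫ x : EuclideanSpace ℝ (Fin n), x i ^ 2 ∂gauss n = 1 := fun i => by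
    rw [← integral_sq_gaussLine, ← (measurePreserving_coord_gauss i).map_eq, integral_map
      (measurePreserving_coord_gauss i).measurable.aemeasurable (by fun_prop)]
  simp [hcoord]

lemma integrable_exp_norm_sq_gauss :
    Integrable (fun x : EuclideanSpace ℝ (Fin n) => Real.exp (‖x‖ ^ 2 / 4)) (gauss n) := by
  have hprod := Integrable.fintype_prod (ι := Fin n) fun _ => integrable_exp_sq_gaussLine
  refine ((measurePreserving_ofLp_gauss.integrable_comp_emb
    (MeasurableEquiv.measurableEmbedding _)).2 hprod).congr (.of_forall fun x => ?_)
  simp [EuclideanSpace.real_norm_sq_eq, ← Real.exp_sum, Finset.sum_div]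

lemma integrable_mul_norm_sq {h : EuclideanSpace ℝ (Fin n) → ℝ} (hh : IsProbDensity (gauss n) h)
    (hent : Integrable (fun x => h x * Real.log (h x)) (gauss n)) :
    Integrable (fun x => h x * ‖x‖ ^ 2) (gauss n) :=
  ((integrable_mul_of_integrable_exp hh.1 hh.2.1 hh.integrable hent (by fun_prop)
    (fun _ => by positivity) integrable_exp_norm_sq_gauss).const_mul 4).congr
    (.of_forall fun x => by ring)

/-- The splitting of a vector into its `i`-th coordinate and the vector of the other ones. -/
def splitCoord (i : Fin (n + 1)) :
    EuclideanSpace ℝ (Fin (n + 1)) ≃ᵐ ℝ × EuclideanSpace ℝ (Fin n) :=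
  ((MeasurableEquiv.toLp 2 _).symm.trans (MeasurableEquiv.piFinSuccAbove (fun _ => ℝ) i)).trans
    ((MeasurableEquiv.refl ℝ).prodCongr (MeasurableEquiv.toLp 2 _))

lemma measurePreserving_splitCoord (i : Fin (n + 1)) :
    MeasurePreserving (splitCoord i) (gauss (n + 1)) (gaussLine.prod (gauss n)) :=
  ((MeasurePreserving.id gaussLine).prod
      ⟨(MeasurableEquiv.toLp 2 _).measurable, map_pi_eq_stdGaussian⟩).comp
    ((measurePreserving_piFinSuccAbove (fun _ => gaussLine) i).comp measurePreserving_ofLp_gauss)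

lemma inner_eq_splitCoord (i : Fin (n + 1)) (x y : EuclideanSpace ℝ (Fin (n + 1))) :
    inner ℝ x y = (splitCoord i x).1 * (splitCoord i y).1 +
      inner ℝ (splitCoord i x).2 (splitCoord i y).2 := by
  rw [PiLp.inner_apply, PiLp.inner_apply, Fin.sum_univ_succAbove _ i]
  simp [splitCoord, MeasurableEquiv.prodCongr, mul_comm]
  rfl

lemma norm_sq_eq_splitCoord (i : Fin (n + 1)) (x : EuclideanSpace ℝ (Fin (n + 1))) :
    ‖x‖ ^ 2 = (splitCoord i x).1 ^ 2 + ‖(splitCoord i x).2‖ ^ 2 := by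
  rw [← real_inner_self_eq_norm_sq, inner_eq_splitCoord i, real_inner_self_eq_norm_sq, ← sq]

end GaussianCoordinates

section Transport

lemma measurePreserving_densMeasure_comp_symm {E F : Type*} [MeasurableSpace E] [MeasurableSpace F]
    {ν : Measure E} {ν' : Measure F} {e : E ≃ᵐ F} (he : MeasurePreserving e ν ν') {h : E → ℝ}
    (hm : Measurable h) :
    MeasurePreserving e (densMeasure ν h) (densMeasure ν' (h ∘ e.symm)) := by
  refine ⟨e.measurable, Measure.ext_of_lintegral _ fun f hf => ?_⟩
  rw [lintegral_map hf e.measurable, lintegral_densMeasure hm (f := fun x => f (e x)) (by fun_prop),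
    lintegral_densMeasure (hm.comp e.symm.measurable) hf,
    ← he.lintegral_comp_emb e.measurableEmbedding]
  simp

variable {E : Type*} [NormedAddCommGroup E] [InnerProductSpace ℝ E]

lemma integrable_inner_of_memLp_two {Ω : Type*} [MeasurableSpace Ω] {μ : Measure Ω} {f g : Ω → E}
    (hf : MemLp f 2 μ) (hg : MemLp g 2 μ) : Integrable (fun ω => inner ℝ (f ω) (g ω)) μ :=
  (hf.norm.integrable_mul hg.norm).mono' (hf.1.inner hg.1)
    (.of_forall fun _ => norm_inner_le_norm _ _)

variable [MeasurableSpace E] [BorelSpace E] [SecondCountableTopology E] {ν : Measure E}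
  [IsProbabilityMeasure ν] {h : ℝ × E → ℝ} {T : E → E}

lemma le_integral_mul_inner_prod (hh : IsProbDensity (gaussLine.prod ν) h)
    (hent : Integrable (fun p => h p * Real.log (h p)) (gaussLine.prod ν))
    (hν : MemLp id 2 ν) (hmom : Integrable (fun x => marginal h x * ‖x‖ ^ 2) ν)
    (hT : MeasurePreserving T (densMeasure ν (marginal h)) ν) {c d : ℝ} (hc : 0 < c)
    (hcorr : c * (d * (1 / 2 - Real.log c) + 1 / 2 * (∫ x, marginal h x * ‖x‖ ^ 2 ∂ν) -
      ∫ x, marginal h x * Real.log (marginal h x) ∂ν) ≤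
        ∫ x, marginal h x * inner ℝ x (T x) ∂ν) :
    c * ((d + 1) * (1 / 2 - Real.log c) +
        1 / 2 * (∫ p, h p * (p.1 ^ 2 + ‖p.2‖ ^ 2) ∂gaussLine.prod ν) -
        ∫ p, h p * Real.log (h p) ∂gaussLine.prod ν) ≤
      ∫ p, h p * (p.1 * condTransport h p + inner ℝ p.2 (T p.2)) ∂gaussLine.prod ν := by
  obtain ⟨hm, h0, -⟩ := id hh
  have hmarg := isProbDensity_marginal hh
  have hsnd := measurePreserving_snd_densMeasure hh
  rw [← integrable_densMeasure_iff hmarg.1 hmarg.2.1] at hmom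
  have hid : MemLp id 2 (densMeasure ν (marginal h)) :=
    (memLp_two_iff_integrable_sq_norm (by fun_prop)).2 hmom
  have hinner : Integrable (fun x => inner ℝ x (T x)) (densMeasure ν (marginal h)) :=
    integrable_inner_of_memLp_two hid (hν.comp_measurePreserving hT)
  have hfst := integrable_mul_fst_sq hh hent
  have hmul := integrable_mul_condTransport hh hfst
  have hsq : Integrable (fun p => h p * ‖p.2‖ ^ 2) (gaussLine.prod ν) := by
    rw [← integrable_densMeasure_iff hm h0]
    exact (hsnd.integrable_comp_of_integrable hmom :)
  have hinner' : Integrable (fun p => h p * inner ℝ p.2 (T p.2)) (gaussLine.prod ν) := by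
    rw [← integrable_densMeasure_iff hm h0]
    exact (hsnd.integrable_comp_of_integrable hinner :)
  simp_rw [mul_add (h _)]
  rw [integral_add hfst hsq, integral_add hmul hinner',
    integral_mul_comp_snd hh (g := fun x => ‖x‖ ^ 2) (by fun_prop),
    integral_mul_comp_snd hh (g := fun x => inner ℝ x (T x)) (measurable_id.inner hT.measurable)]
  linarith [le_integral_mul_condTransport hh hent hc]

theorem exists_transport (n : ℕ) {h : EuclideanSpace ℝ (Fin n) → ℝ}
    (hh : IsProbDensity (gauss n) h)
    (hent : Integrable (fun x => h x * Real.log (h x)) (gauss n)) :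
    ∃ T : EuclideanSpace ℝ (Fin n) → EuclideanSpace ℝ (Fin n),
      MeasurePreserving T (densMeasure (gauss n) h) (gauss n) ∧ ∀ c : ℝ, 0 < c →
        c * (n * (1 / 2 - Real.log c) + 1 / 2 * (∫ x, h x * ‖x‖ ^ 2 ∂gauss n) -
          ∫ x, h x * Real.log (h x) ∂gauss n) ≤ ∫ x, h x * inner ℝ x (T x) ∂gauss n := by
  induction n with
  | zero =>
    have hconst : h = fun _ => h 0 := funext fun x => congrArg h (Subsingleton.elim x 0)
    obtain rfl : h = fun _ => 1 := by
      have hint := hh.2.2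
      rw [hconst, integral_const, probReal_univ, one_smul] at hint
      rwa [hint] at hconst
    exact ⟨id, ⟨measurable_id, by simp [densMeasure]⟩, fun c _ => by
      simp [Subsingleton.elim _ (0 : EuclideanSpace ℝ (Fin 0))]⟩
  | succ n ih =>
    let e := splitCoord (0 : Fin (n + 1))
    have he := measurePreserving_splitCoord (0 : Fin (n + 1))
    have hes := he.symm e
    let k := h ∘ e.symm
    have hcomp : ∀ F : ℝ → ℝ × EuclideanSpace ℝ (Fin n) → ℝ,
        ∫ p, F (k p) p ∂gaussLine.prod (gauss n) = ∫ x, F (h x) (e x) ∂gauss (n + 1) := fun F => by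
      rw [← hes.integral_comp e.symm.measurableEmbedding]
      simp [k]
    have hk : IsProbDensity (gaussLine.prod (gauss n)) k :=
      ⟨hh.1.comp e.symm.measurable, fun p => hh.2.1 _, (hcomp fun s _ => s).trans hh.2.2⟩
    have hkent : Integrable (fun p => k p * Real.log (k p)) (gaussLine.prod (gauss n)) :=
      (hes.integrable_comp_emb e.symm.measurableEmbedding).2 hent
    have hment := integrable_marginal_mul_log hk hkent
    have hmarg := isProbDensity_marginal hk
    obtain ⟨T, hT, hcorr⟩ := ih hmarg hment
    have := hmarg.isProbabilityMeasure
    refine ⟨fun x => e.symm (condTransport k (e x), T (e x).2), ?_, fun c hc => ?_⟩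
    · exact hes.comp ((((MeasurePreserving.id gaussLine).prod hT).comp
        (measurePreserving_condTransport_prodMk hk)).comp
          (measurePreserving_densMeasure_comp_symm he hh.1))
    · have hstep := le_integral_mul_inner_prod hk hkent IsGaussian.memLp_two_id
        (integrable_mul_norm_sq hmarg hment) hT hc (hcorr c hc)
      rw [hcomp fun s p => s * (p.1 ^ 2 + ‖p.2‖ ^ 2), hcomp fun s _ => s * Real.log s,
        hcomp fun s p => s * (p.1 * condTransport k p + inner ℝ p.2 (T p.2))] at hstep
      simpa only [Nat.cast_succ, norm_sq_eq_splitCoord (0 : Fin (n + 1)),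
        inner_eq_splitCoord (0 : Fin (n + 1)), e, MeasurableEquiv.apply_symm_apply] using hstep

end Transport

section Wasserstein

lemma W2_sq_le_of_isCoupling {E : Type*} [PseudoEMetricSpace E] [MeasurableSpace E]
    {μ ν : Measure E} {π : Measure (E × E)} (hπ : IsCoupling π μ ν) :
    W2 μ ν ^ 2 ≤ ∫⁻ p, edist p.1 p.2 ^ 2 / 2 ∂π := by
  calc W2 μ ν ^ 2 ≤ ((∫⁻ p, edist p.1 p.2 ^ 2 / 2 ∂π) ^ (1 / 2 : ℝ)) ^ 2 := by
        gcongr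
        exact iInf₂_le π hπ
    _ = _ := by
        rw [← ENNReal.rpow_natCast, ← ENNReal.rpow_mul]
        norm_num

lemma isCoupling_map_prodMk {E : Type*} [MeasurableSpace E] {μ ν : Measure E} {T : E → E}
    (hT : MeasurePreserving T μ ν) : IsCoupling (μ.map fun x => (x, T x)) μ ν :=
  ⟨by rw [Measure.fst_map_prodMk hT.measurable, Measure.map_id'],
    by rw [Measure.snd_map_prodMk measurable_id', hT.map_eq]⟩

lemma isCoupling_prod {E : Type*} [MeasurableSpace E] (μ ν : Measure E) [IsProbabilityMeasure μ]
    [IsProbabilityMeasure ν] : IsCoupling (μ.prod ν) μ ν :=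
  ⟨by simp, by simp⟩

lemma edist_sq_div_two {E : Type*} [SeminormedAddCommGroup E] (x y : E) :
    edist x y ^ 2 / 2 = ENNReal.ofReal (1 / 2 * ‖x - y‖ ^ 2) := by
  rw [edist_dist, dist_eq_norm, one_div_mul_eq_div, ENNReal.ofReal_div_of_pos two_pos,
    ENNReal.ofReal_pow (norm_nonneg _), ENNReal.ofReal_ofNat]

lemma half_norm_sub_sq {E : Type*} [NormedAddCommGroup E] [InnerProductSpace ℝ E] (x y : E) :
    1 / 2 * ‖x - y‖ ^ 2 = 1 / 2 * ‖x‖ ^ 2 + 1 / 2 * ‖y‖ ^ 2 - inner ℝ x y := by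
  rw [norm_sub_sq_real]
  ring

variable {E : Type*} [NormedAddCommGroup E] [InnerProductSpace ℝ E] [MeasurableSpace E]
  [BorelSpace E] [SecondCountableTopology E] {μ ν : Measure E}

lemma IsCoupling.W2_sq_le {π : Measure (E × E)} (hπ : IsCoupling π μ ν) (hμ : MemLp id 2 μ)
    (hν : MemLp id 2 ν) :
    ((W2 μ ν ^ 2 : ℝ≥0∞) : EReal) ≤
      ((1 / 2 * (∫ x, ‖x‖ ^ 2 ∂μ) + 1 / 2 * (∫ y, ‖y‖ ^ 2 ∂ν) - ∫ p, inner ℝ p.1 p.2 ∂π : ℝ) :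
        EReal) := by
  have hfst : MeasurePreserving Prod.fst π μ := ⟨measurable_fst, hπ.1⟩
  have hsnd : MeasurePreserving Prod.snd π ν := ⟨measurable_snd, hπ.2⟩
  have hx : MemLp (Prod.fst : E × E → E) 2 π := hμ.comp_measurePreserving hfst
  have hy : MemLp (Prod.snd : E × E → E) 2 π := hν.comp_measurePreserving hsnd
  have hx2 := (hx.integrable_norm_pow two_ne_zero).const_mul (1 / 2)
  have hy2 := (hy.integrable_norm_pow two_ne_zero).const_mul (1 / 2)
  have hxy := integrable_inner_of_memLp_two hx hy
  have hcost : ∫ p, 1 / 2 * ‖p.1 - p.2‖ ^ 2 ∂π = 1 / 2 * (∫ x, ‖x‖ ^ 2 ∂μ) +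
      1 / 2 * (∫ y, ‖y‖ ^ 2 ∂ν) - ∫ p, inner ℝ p.1 p.2 ∂π := by
    simp_rw [half_norm_sub_sq]
    rw [integral_sub (by exact hx2.add hy2) hxy, integral_add hx2 hy2, integral_const_mul,
      integral_const_mul, ← hfst.map_eq, ← hsnd.map_eq,
      integral_map hfst.measurable.aemeasurable (by fun_prop),
      integral_map hsnd.measurable.aemeasurable (by fun_prop)]
  have hint : Integrable (fun p => 1 / 2 * ‖p.1 - p.2‖ ^ 2) π :=
    ((hx2.add hy2).sub hxy).congr (.of_forall fun p => (half_norm_sub_sq p.1 p.2).symm)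
  refine (EReal.coe_ennreal_le_coe_ennreal_iff.2 (W2_sq_le_of_isCoupling hπ)).trans (le_of_eq ?_)
  simp_rw [edist_sq_div_two]
  rw [← ofReal_integral_eq_lintegral_ofReal hint (.of_forall fun p => by positivity),
    EReal.coe_ennreal_ofReal, max_eq_left (integral_nonneg fun p => by positivity), hcost]

lemma W2_sq_le_of_integral_eq_zero [CompleteSpace E] [IsProbabilityMeasure μ]
    [IsProbabilityMeasure ν] (hμ : MemLp id 2 μ) (hν : MemLp id 2 ν) (hν0 : ∫ y, y ∂ν = 0) :
    ((W2 μ ν ^ 2 : ℝ≥0∞) : EReal) ≤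
      ((1 / 2 * (∫ x, ‖x‖ ^ 2 ∂μ) + 1 / 2 * (∫ y, ‖y‖ ^ 2 ∂ν) : ℝ) : EReal) := by
  have hinner : Integrable (fun p : E × E => inner ℝ p.1 p.2) (μ.prod ν) :=
    integrable_inner_of_memLp_two (hμ.comp_measurePreserving measurePreserving_fst)
      (hν.comp_measurePreserving measurePreserving_snd)
  have hzero : ∫ p, inner ℝ p.1 p.2 ∂μ.prod ν = 0 := by
    rw [integral_prod _ hinner]
    refine integral_eq_zero_of_ae (.of_forall fun x => ?_)
    exact (integral_inner (hν.integrable one_le_two) x).trans (by simp [hν0])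
  simpa only [hzero, sub_zero] using (isCoupling_prod μ ν).W2_sq_le hμ hν

end Wasserstein

section Talagrand

variable {n : ℕ} {h : EuclideanSpace ℝ (Fin n) → ℝ}

lemma memLp_id_densMeasure (hh : IsProbDensity (gauss n) h)
    (hmom : Integrable (fun x => h x * ‖x‖ ^ 2) (gauss n)) :
    MemLp id 2 (densMeasure (gauss n) h) :=
  (memLp_two_iff_integrable_sq_norm (by fun_prop)).2
    ((integrable_densMeasure_iff hh.1 hh.2.1).2 hmom)

lemma W2_sq_le_moment (hh : IsProbDensity (gauss n) h)
    (hmom : Integrable (fun x => h x * ‖x‖ ^ 2) (gauss n)) :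
    ((W2 (densMeasure (gauss n) h) (gauss n) ^ 2 : ℝ≥0∞) : EReal) ≤
      ((1 / 2 * (∫ x, h x * ‖x‖ ^ 2 ∂gauss n) + n / 2 : ℝ) : EReal) := by
  have := hh.isProbabilityMeasure
  have hW := W2_sq_le_of_integral_eq_zero (memLp_id_densMeasure hh hmom)
    (IsGaussian.memLp_two_id (μ := gauss n)) integral_id_stdGaussian
  rwa [integral_densMeasure hh.1 hh.2.1, integral_norm_sq_gauss, one_div_mul_eq_div 2 (n : ℝ)] at hW

lemma W2_sq_le_entropy (hh : IsProbDensity (gauss n) h)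
    (hent : Integrable (fun x => h x * Real.log (h x)) (gauss n)) {c : ℝ} (hc : 0 < c) :
    ((W2 (densMeasure (gauss n) h) (gauss n) ^ 2 : ℝ≥0∞) : EReal) ≤
      ((1 / 2 * (∫ x, h x * ‖x‖ ^ 2 ∂gauss n) + n / 2 -
        c * (n * (1 / 2 - Real.log c) + 1 / 2 * (∫ x, h x * ‖x‖ ^ 2 ∂gauss n) -
          ∫ x, h x * Real.log (h x) ∂gauss n) : ℝ) : EReal) := by
  obtain ⟨T, hT, hcorr⟩ := exists_transport n hh hent
  have hW := (isCoupling_map_prodMk hT).W2_sq_le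
    (memLp_id_densMeasure hh (integrable_mul_norm_sq hh hent)) IsGaussian.memLp_two_id
  rw [integral_map (measurable_id'.prodMk hT.measurable).aemeasurable (by fun_prop),
    integral_densMeasure hh.1 hh.2.1, integral_densMeasure hh.1 hh.2.1, integral_norm_sq_gauss,
    one_div_mul_eq_div 2 (n : ℝ)] at hW
  exact hW.trans (EReal.coe_le_coe (sub_le_sub_left (hcorr c hc) _))

theorem classicalTalagrand (n : ℕ) : ClassicalTalagrand n := by
  intro h hh
  unfold Ent
  split_ifs with hent
  · refine (W2_sq_le_entropy hh hent one_pos).trans (EReal.coe_le_coe ?_)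
    rw [hh.2.2, Real.log_one]
    linarith
  · exact le_top

end Talagrand

section SteinLemma

lemma integral_deriv_gaussLine {v : ℝ → ℝ} (hv : Differentiable ℝ v) (hint : Integrable v gaussLine)
    (hmul : Integrable (fun t => t * v t) gaussLine) (hderiv : Integrable (deriv v) gaussLine) :
    ∫ t, deriv v t ∂gaussLine = ∫ t, t * v t ∂gaussLine := by
  rw [integrable_gaussLine_iff] at hint hmul hderiv
  rw [integral_gaussLine, integral_gaussLine]
  have hparts := integral_mul_deriv_eq_deriv_mul_of_integrable (u := gaussianPDFReal 0 1) (v := v)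
    (fun x _ => hasDerivAt_gaussianPDFReal x) (fun x _ => (hv x).hasDerivAt) hderiv
    (hmul.neg.congr (.of_forall fun t => by simp only [Pi.neg_apply, Pi.mul_apply]; ring)) hint
  rw [hparts, ← integral_neg]
  exact integral_congr_ae (.of_forall fun t => by ring)

variable {n : ℕ}

lemma splitCoord_symm_apply (i : Fin (n + 1)) (t : ℝ) (y : EuclideanSpace ℝ (Fin n)) :
    (splitCoord i).symm (t, y) = (splitCoord i).symm (0, y) + t • EuclideanSpace.single i 1 := by
  ext j
  rcases Fin.eq_self_or_eq_succAbove i j with rfl | ⟨k, rfl⟩ <;>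
    simp [splitCoord, MeasurableEquiv.prodCongr]

lemma splitCoord_symm_apply_self (i : Fin (n + 1)) (t : ℝ) (y : EuclideanSpace ℝ (Fin n)) :
    (splitCoord i).symm (t, y) i = t := by
  simp [splitCoord, MeasurableEquiv.prodCongr]

lemma hasDerivAt_comp_splitCoord_symm {u : EuclideanSpace ℝ (Fin (n + 1)) → ℝ}
    (hu : Differentiable ℝ u) (i : Fin (n + 1)) (y : EuclideanSpace ℝ (Fin n)) (t : ℝ) :
    HasDerivAt (fun t => u ((splitCoord i).symm (t, y)))
      (fderiv ℝ u ((splitCoord i).symm (t, y)) (EuclideanSpace.single i 1)) t := by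
  have hline : HasDerivAt (fun t => (splitCoord i).symm (t, y)) (EuclideanSpace.single i 1) t := by
    refine HasDerivAt.congr_of_eventuallyEq ?_ (.of_forall fun s => splitCoord_symm_apply i s y)
    simpa using ((hasDerivAt_id t).smul_const (EuclideanSpace.single i (1 : ℝ))).const_add
      ((splitCoord i).symm (0, y))
  exact (hu _).hasFDerivAt.comp_hasDerivAt t hline

end SteinLemma

section PartialDeriv

variable {n : ℕ} {i : Fin n} {f g u : EuclideanSpace ℝ (Fin n) → ℝ}

/-- The `i`-th partial derivative of a function on `ℝⁿ`. -/
def partialDeriv (i : Fin n) (f : EuclideanSpace ℝ (Fin n) → ℝ) (x : EuclideanSpace ℝ (Fin n)) :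
    ℝ :=
  fderiv ℝ f x (EuclideanSpace.single i 1)

lemma contDiff_partialDeriv {k : ℕ} (hf : ContDiff ℝ (k + 1) f) :
    ContDiff ℝ k (partialDeriv i f) :=
  (hf.fderiv_right le_rfl).clm_apply contDiff_const

lemma hasCompactSupport_partialDeriv (hf : HasCompactSupport f) :
    HasCompactSupport (partialDeriv i f) :=
  hf.fderiv_apply (𝕜 := ℝ) _

lemma partialDeriv_mul (hf : Differentiable ℝ f) (hg : Differentiable ℝ g) :
    partialDeriv i (fun x => f x * g x) = fun x => f x * partialDeriv i g x +
      g x * partialDeriv i f x := by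
  ext x
  simp [partialDeriv, fderiv_fun_mul (hf x) (hg x)]

lemma partialDeriv_coord_mul (hf : Differentiable ℝ f) :
    partialDeriv i (fun x => x i * f x) = fun x => x i * partialDeriv i f x + f x := by
  have hproj : partialDeriv i (fun x => x i) = 1 := by
    ext x
    have hproj' : HasFDerivAt (fun x : EuclideanSpace ℝ (Fin n) => x i) _ x :=
      (EuclideanSpace.proj (𝕜 := ℝ) i).hasFDerivAt
    simp [partialDeriv, hproj'.fderiv]
  rw [partialDeriv_mul (f := fun x => x i) (by fun_prop) hf, hproj]
  simp

lemma sum_coord_mul_partialDeriv (f : EuclideanSpace ℝ (Fin n) → ℝ)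
    (x : EuclideanSpace ℝ (Fin n)) : ∑ i, x i * partialDeriv i f x = fderiv ℝ f x x := by
  conv_rhs => rw [← congrArg (fderiv ℝ f x) ((EuclideanSpace.basisFun (Fin n) ℝ).sum_repr x)]
  simp [partialDeriv]

lemma sum_partialDeriv_mul_partialDeriv (f g : EuclideanSpace ℝ (Fin n) → ℝ)
    (x : EuclideanSpace ℝ (Fin n)) :
    ∑ i, partialDeriv i f x * partialDeriv i g x = inner ℝ (gradient f x) (gradient g x) := by
  rw [← (EuclideanSpace.basisFun (Fin n) ℝ).sum_inner_mul_inner]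
  simp [partialDeriv, inner_gradient_left, inner_gradient_right]

lemma laplacian_eq_sum_partialDeriv (hf : ContDiff ℝ 2 f) (x : EuclideanSpace ℝ (Fin n)) :
    Laplacian.laplacian f x = ∑ i, partialDeriv i (partialDeriv i f) x := by
  rw [InnerProductSpace.laplacian_eq_iteratedFDeriv_orthonormalBasis f
    (EuclideanSpace.basisFun (Fin n) ℝ)]
  refine Finset.sum_congr rfl fun i _ => ?_
  have hd : DifferentiableAt ℝ (fderiv ℝ f) x :=
    (hf.fderiv_right (m := 1) le_rfl).differentiable one_ne_zero x
  have hd' : HasFDerivAt (partialDeriv i f) _ x :=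
    hd.hasFDerivAt.clm_apply (hasFDerivAt_const (EuclideanSpace.single i (1 : ℝ)) x)
  rw [partialDeriv, hd'.fderiv]
  simp [iteratedFDeriv_two_apply]

lemma continuous_laplacian (hf : ContDiff ℝ 2 f) :
    Continuous fun x => Laplacian.laplacian f x := by
  simp_rw [laplacian_eq_sum_partialDeriv hf]
  exact continuous_finsetSum _ fun i _ =>
    (contDiff_partialDeriv (k := 0) (contDiff_partialDeriv (k := 1) hf)).continuous

lemma hasCompactSupport_laplacian (hc : HasCompactSupport f) :
    HasCompactSupport fun x => Laplacian.laplacian f x :=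
  HasCompactSupport.intro hc fun x hx => by
    rw [(InnerProductSpace.laplacian_congr_nhds
      (notMem_tsupport_iff_eventuallyEq.1 hx)).eq_of_nhds]
    exact congrFun (InnerProductSpace.laplacian_const (c := (0 : ℝ))) x

lemma partialDeriv_comp_smul (i : Fin n) (f : EuclideanSpace ℝ (Fin n) → ℝ) (c : ℝ) :
    partialDeriv i (fun x => f (c • x)) = fun x => c * partialDeriv i f (c • x) := by
  ext x
  rw [partialDeriv, fderiv_comp_smul]
  rfl

lemma laplacian_comp_smul (hf : ContDiff ℝ 2 f) (c : ℝ) (x : EuclideanSpace ℝ (Fin n)) :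
    Laplacian.laplacian (fun x => f (c • x)) x = c ^ 2 * Laplacian.laplacian f (c • x) := by
  rw [laplacian_eq_sum_partialDeriv (hf.fun_comp (contDiff_const_smul c)),
    laplacian_eq_sum_partialDeriv hf, Finset.mul_sum]
  refine Finset.sum_congr rfl fun i _ => ?_
  have hscale : partialDeriv i (fun x => f (c • x)) = c • fun x => partialDeriv i f (c • x) :=
    partialDeriv_comp_smul i f c
  rw [hscale, partialDeriv, fderiv_const_smul_field, sq, mul_assoc]
  exact congrArg (c * ·) (congrFun (partialDeriv_comp_smul i (partialDeriv i f) c) x)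

lemma integrable_comp_splitCoord_symm {f : EuclideanSpace ℝ (Fin (n + 1)) → ℝ}
    (hf : Integrable f (gauss (n + 1))) (i : Fin (n + 1)) :
    Integrable (fun p => f ((splitCoord i).symm p)) (gaussLine.prod (gauss n)) :=
  (((measurePreserving_splitCoord i).symm (splitCoord i)).integrable_comp_of_integrable hf :)

lemma integral_gauss_eq_integral_splitCoord {f : EuclideanSpace ℝ (Fin (n + 1)) → ℝ}
    (hf : Integrable f (gauss (n + 1))) (i : Fin (n + 1)) :
    ∫ x, f x ∂gauss (n + 1) = ∫ y, ∫ t, f ((splitCoord i).symm (t, y)) ∂gaussLine ∂gauss n := by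
  rw [← ((measurePreserving_splitCoord i).symm (splitCoord i)).integral_comp'
    (f := (splitCoord i).symm) f]
  exact integral_prod_symm _ (integrable_comp_splitCoord_symm hf i)

lemma integral_partialDeriv_gauss (hu : ContDiff ℝ 1 u) (hc : HasCompactSupport u) :
    ∫ x, partialDeriv i u x ∂gauss n = ∫ x, x i * u x ∂gauss n := by
  cases n with
  | zero => exact i.elim0
  | succ n =>
    have hint : Integrable u (gauss (n + 1)) := hu.continuous.integrable_of_hasCompactSupport hc
    have hmul : Integrable (fun x => x i * u x) (gauss (n + 1)) :=
      Continuous.integrable_of_hasCompactSupport (by fun_prop) hc.mul_left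
    have hderiv : Integrable (partialDeriv i u) (gauss (n + 1)) :=
      (contDiff_partialDeriv (k := 0) hu).continuous.integrable_of_hasCompactSupport
        (hasCompactSupport_partialDeriv hc)
    rw [integral_gauss_eq_integral_splitCoord hderiv i,
      integral_gauss_eq_integral_splitCoord hmul i]
    refine integral_congr_ae ?_
    filter_upwards [(integrable_comp_splitCoord_symm hint i).prod_left_ae,
      (integrable_comp_splitCoord_symm hmul i).prod_left_ae,
      (integrable_comp_splitCoord_symm hderiv i).prod_left_ae] with y hy hymul hyderiv
    have hd := hasDerivAt_comp_splitCoord_symm (hu.differentiable one_ne_zero) i y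
    have hd' : deriv (fun t => u ((splitCoord i).symm (t, y))) =
        fun t => partialDeriv i u ((splitCoord i).symm (t, y)) := funext fun t => (hd t).deriv
    simp only [splitCoord_symm_apply_self] at hymul ⊢
    rw [← hd'] at hyderiv ⊢
    exact integral_deriv_gaussLine (fun t => (hd t).differentiableAt) hy hymul hyderiv

lemma integral_mul_partialDeriv_gauss (hf : ContDiff ℝ 1 f) (hg : ContDiff ℝ 1 g)
    (hc : HasCompactSupport g) :
    ∫ x, g x * partialDeriv i f x ∂gauss n =
      ∫ x, f x * (x i * g x - partialDeriv i g x) ∂gauss n := by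
  have hf' := (contDiff_partialDeriv (i := i) (k := 0) hf).continuous
  have hg' := (contDiff_partialDeriv (i := i) (k := 0) hg).continuous
  have hstein := integral_partialDeriv_gauss (i := i) (hf.mul hg) hc.mul_left
  have hint₁ : Integrable (fun x => g x * partialDeriv i f x) (gauss n) :=
    (hg.continuous.mul hf').integrable_of_hasCompactSupport hc.mul_right
  have hint₂ : Integrable (fun x => f x * partialDeriv i g x) (gauss n) :=
    (hf.continuous.mul hg').integrable_of_hasCompactSupport
      (hasCompactSupport_partialDeriv hc).mul_left
  have hint₃ : Integrable (fun x => x i * (f x * g x)) (gauss n) :=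
    Continuous.integrable_of_hasCompactSupport (by fun_prop) hc.mul_left.mul_left
  rw [partialDeriv_mul (hf.differentiable one_ne_zero) (hg.differentiable one_ne_zero),
    integral_add hint₂ hint₁] at hstein
  rw [← sub_eq_iff_eq_add'.2 hstein.symm, ← integral_sub hint₃ hint₂]
  exact integral_congr_ae (.of_forall fun x => by ring)

lemma partialDeriv_coord_mul_sub_partialDeriv (hg : ContDiff ℝ 2 g) (x : EuclideanSpace ℝ (Fin n)) :
    partialDeriv i (fun x => x i * g x - partialDeriv i g x) x =
      x i * partialDeriv i g x + g x - partialDeriv i (partialDeriv i g) x := by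
  have hg' : Differentiable ℝ g := hg.differentiable two_ne_zero
  have hdg : Differentiable ℝ (partialDeriv i g) :=
    (contDiff_partialDeriv (k := 1) hg).differentiable (by simp)
  rw [← congrFun (partialDeriv_coord_mul hg') x, partialDeriv, fderiv_fun_sub (by fun_prop) (hdg x)]
  rfl

lemma integral_mul_partialDeriv_partialDeriv_gauss (hf : ContDiff ℝ 2 f) (hg : ContDiff ℝ 2 g)
    (hc : HasCompactSupport g) :
    ∫ x, g x * partialDeriv i (partialDeriv i f) x ∂gauss n = ∫ x, f x * (g x * (x i ^ 2 - 1) +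
      (partialDeriv i (partialDeriv i g) x - 2 * (x i * partialDeriv i g x))) ∂gauss n := by
  have hdg : ContDiff ℝ 1 (partialDeriv i g) := contDiff_partialDeriv hg
  have hδ : ContDiff ℝ 1 fun x => x i * g x - partialDeriv i g x :=
    ((EuclideanSpace.proj (𝕜 := ℝ) i).contDiff.mul (hg.of_le one_le_two)).sub hdg
  rw [integral_mul_partialDeriv_gauss (contDiff_partialDeriv hf) (hg.of_le one_le_two) hc]
  simp_rw [mul_comm (partialDeriv i f _)]
  rw [integral_mul_partialDeriv_gauss (hf.of_le one_le_two) hδ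
    (hc.mul_left.sub (hasCompactSupport_partialDeriv hc))]
  refine integral_congr_ae (.of_forall fun x => ?_)
  simp only [partialDeriv_coord_mul_sub_partialDeriv hg]
  ring

lemma integral_mul_laplacian_gauss (hf : ContDiff ℝ 2 f) (hg : ContDiff ℝ 2 g)
    (hc : HasCompactSupport g) :
    ∫ x, g x * Laplacian.laplacian f x ∂gauss n = ∫ x, f x * (g x * (‖x‖ ^ 2 - n) +
      (Laplacian.laplacian g x - 2 * fderiv ℝ g x x)) ∂gauss n := by
  have hdg (i) : ContDiff ℝ 1 (partialDeriv i g) := contDiff_partialDeriv hg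
  have hddf (i) : Continuous (partialDeriv i (partialDeriv i f)) :=
    (contDiff_partialDeriv (k := 0) (contDiff_partialDeriv (k := 1) hf)).continuous
  have hddg (i) : Continuous (partialDeriv i (partialDeriv i g)) :=
    (contDiff_partialDeriv (k := 0) (hdg i)).continuous
  have hintf (i) : Integrable (fun x => g x * partialDeriv i (partialDeriv i f) x) (gauss n) :=
    (hg.continuous.mul (hddf i)).integrable_of_hasCompactSupport hc.mul_right
  have hintg (i) : Integrable (fun x => f x * (g x * (x i ^ 2 - 1) +
      (partialDeriv i (partialDeriv i g) x - 2 * (x i * partialDeriv i g x)))) (gauss n) := by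
    have hcd := hasCompactSupport_partialDeriv (i := i) hc
    have hcdg := (hdg i).continuous
    refine Continuous.integrable_of_hasCompactSupport (by fun_prop) (hc.mul_right.add
      ((hasCompactSupport_partialDeriv hcd).sub hcd.mul_left.mul_left)).mul_left
  simp_rw [laplacian_eq_sum_partialDeriv hf, laplacian_eq_sum_partialDeriv hg, Finset.mul_sum]
  rw [integral_finsetSum _ fun i _ => hintf i]
  simp_rw [integral_mul_partialDeriv_partialDeriv_gauss hf hg hc]
  rw [← integral_finsetSum _ fun i _ => hintg i]
  refine integral_congr_ae (.of_forall fun x => ?_)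
  simp only [← Finset.mul_sum, Finset.sum_add_distrib, Finset.sum_sub_distrib, Finset.sum_const,
    Finset.card_univ, Fintype.card_fin, nsmul_eq_mul, mul_one, EuclideanSpace.real_norm_sq_eq,
    sum_coord_mul_partialDeriv]

lemma integral_mul_laplacian_gauss_eq_integral_inner (hf : ContDiff ℝ 2 f) (hg : ContDiff ℝ 1 g)
    (hc : HasCompactSupport g) :
    ∫ x, g x * Laplacian.laplacian f x ∂gauss n =
      ∫ x, (g x * fderiv ℝ f x x - inner ℝ (gradient g x) (gradient f x)) ∂gauss n := by
  have hdf (i) : ContDiff ℝ 1 (partialDeriv i f) := contDiff_partialDeriv hf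
  have hddf (i) : Continuous (partialDeriv i (partialDeriv i f)) :=
    (contDiff_partialDeriv (k := 0) (hdf i)).continuous
  have hintf (i) : Integrable (fun x => g x * partialDeriv i (partialDeriv i f) x) (gauss n) :=
    (hg.continuous.mul (hddf i)).integrable_of_hasCompactSupport hc.mul_right
  have hintg (i) : Integrable (fun x => partialDeriv i f x * (x i * g x - partialDeriv i g x))
      (gauss n) := by
    have hcdf := (hdf i).continuous
    have hcdg := (contDiff_partialDeriv (i := i) (k := 0) hg).continuous
    exact Continuous.integrable_of_hasCompactSupport (by fun_prop)
      (hc.mul_left.sub (hasCompactSupport_partialDeriv hc)).mul_left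
  simp_rw [laplacian_eq_sum_partialDeriv hf, Finset.mul_sum]
  rw [integral_finsetSum _ fun i _ => hintf i]
  simp_rw [integral_mul_partialDeriv_gauss (hdf _) hg hc]
  rw [← integral_finsetSum _ fun i _ => hintg i]
  refine integral_congr_ae (.of_forall fun x => ?_)
  simp only [← sum_coord_mul_partialDeriv, ← sum_partialDeriv_mul_partialDeriv, Finset.mul_sum,
    ← Finset.sum_sub_distrib]
  exact Finset.sum_congr rfl fun i _ => by ring

end PartialDeriv

section Cutoff

variable {E : Type*} [NormedAddCommGroup E] [InnerProductSpace ℝ E]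

/-- Smooth cut-off functions on the balls of radius `N + 1`, obtained from one bump function by
dilation, so that their derivatives are bounded uniformly in `N`. -/
def cutoff (N : ℕ) (x : E) : ℝ :=
  (⟨1, 2, one_pos, one_lt_two⟩ : ContDiffBump (0 : E)) ((N + 1 : ℝ)⁻¹ • x)

lemma contDiff_cutoff {k : ℕ∞} (N : ℕ) : ContDiff ℝ k (cutoff N : E → ℝ) :=
  ContDiffBump.contDiff _ |>.comp (contDiff_const_smul _)

lemma cutoff_nonneg (N : ℕ) (x : E) : 0 ≤ cutoff N x :=
  ContDiffBump.nonneg _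

lemma abs_cutoff_le_one (N : ℕ) (x : E) : |cutoff N x| ≤ 1 := by
  rw [abs_of_nonneg (cutoff_nonneg N x)]
  exact ContDiffBump.le_one _

lemma cutoff_eq_one {N : ℕ} {x : E} (hx : ‖x‖ ≤ N + 1) : cutoff N x = 1 := by
  refine ContDiffBump.one_of_mem_closedBall _ ?_
  rw [mem_closedBall_zero_iff, norm_smul, Real.norm_of_nonneg (by positivity)]
  exact inv_mul_le_one_of_le₀ hx (by positivity)

lemma cutoff_eventuallyEq_one (x : E) : ∀ᶠ N : ℕ in atTop, cutoff N =ᶠ[𝓝 x] 1 := by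
  filter_upwards [tendsto_natCast_atTop_atTop.eventually_ge_atTop ‖x‖] with N hN
  filter_upwards [(continuous_norm.tendsto x).eventually_lt_const (hN.trans_lt (lt_add_one _))]
    with y hy using cutoff_eq_one hy.le

lemma tendsto_cutoff (x : E) : Tendsto (fun N : ℕ => cutoff N x) atTop (𝓝 1) :=
  tendsto_const_nhds.congr' ((cutoff_eventuallyEq_one x).mono fun _ hN => hN.eq_of_nhds.symm)

lemma cutoff_eq_cutoff_zero_smul (N : ℕ) :
    (cutoff N : E → ℝ) = fun x => cutoff 0 ((N + 1 : ℝ)⁻¹ • x) := by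
  ext x
  simp [cutoff]

lemma fderiv_cutoff (N : ℕ) (x : E) :
    fderiv ℝ (cutoff N) x = (N + 1 : ℝ)⁻¹ • fderiv ℝ (cutoff 0) ((N + 1 : ℝ)⁻¹ • x) := by
  rw [cutoff_eq_cutoff_zero_smul N, fderiv_comp_smul]

variable [FiniteDimensional ℝ E]

lemma hasCompactSupport_cutoff (N : ℕ) : HasCompactSupport (cutoff N : E → ℝ) :=
  (ContDiffBump.hasCompactSupport _).comp_smul (by positivity)

lemma exists_norm_fderiv_cutoff_le :
    ∃ C, ∀ (N : ℕ) (x : E), ‖fderiv ℝ (cutoff N) x‖ ≤ C / (N + 1) := by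
  obtain ⟨C, hC⟩ := ((contDiff_cutoff (k := 1) 0).continuous_fderiv
    one_ne_zero).bounded_above_of_compact_support ((hasCompactSupport_cutoff (E := E) 0).fderiv ℝ)
  refine ⟨C, fun N x => ?_⟩
  rw [fderiv_cutoff, norm_smul, Real.norm_of_nonneg (by positivity), inv_mul_eq_div]
  gcongr
  exact hC _

variable {n : ℕ}

/-- The terms carrying derivatives of the cut-off `χ` when the adjoint of the Laplacian in
`L²(γ)` is applied to `χ`. -/
def cutoffRemainder (N : ℕ) (x : EuclideanSpace ℝ (Fin n)) : ℝ :=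
  Laplacian.laplacian (cutoff N : EuclideanSpace ℝ (Fin n) → ℝ) x - 2 * fderiv ℝ (cutoff N) x x

lemma continuous_cutoffRemainder (N : ℕ) :
    Continuous (cutoffRemainder N : EuclideanSpace ℝ (Fin n) → ℝ) :=
  (continuous_laplacian (contDiff_cutoff N)).sub (continuous_const.mul
    (((contDiff_cutoff (k := 1) N).continuous_fderiv one_ne_zero).clm_apply continuous_id))

lemma cutoffRemainder_eventuallyEq_zero (x : EuclideanSpace ℝ (Fin n)) :
    ∀ᶠ N : ℕ in atTop, cutoffRemainder N x = 0 := by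
  filter_upwards [cutoff_eventuallyEq_one x] with N hN
  have hlap := (InnerProductSpace.laplacian_congr_nhds hN).eq_of_nhds
  have hone : Laplacian.laplacian (1 : EuclideanSpace ℝ (Fin n) → ℝ) x = 0 :=
    congrFun (InnerProductSpace.laplacian_const (c := (1 : ℝ))) x
  rw [cutoffRemainder, hlap, hone, hN.fderiv_eq]
  simp

lemma exists_abs_cutoffRemainder_le (n : ℕ) :
    ∃ C, ∀ (N : ℕ) (x : EuclideanSpace ℝ (Fin n)), |cutoffRemainder N x| ≤ C := by
  have hχ : ContDiff ℝ 2 (cutoff 0 : EuclideanSpace ℝ (Fin n) → ℝ) := contDiff_cutoff 0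
  have hc : HasCompactSupport (cutoff 0 : EuclideanSpace ℝ (Fin n) → ℝ) :=
    hasCompactSupport_cutoff 0
  obtain ⟨C₁, hC₁⟩ := (continuous_laplacian hχ).bounded_above_of_compact_support
    (hasCompactSupport_laplacian hc)
  obtain ⟨C₂, hC₂⟩ := ((hχ.continuous_fderiv two_ne_zero).clm_apply
    continuous_id).bounded_above_of_compact_support
    ((hc.fderiv ℝ).mono' fun x hx => subset_tsupport _
      fun h => hx (by simp [h]))
  refine ⟨C₁ + 2 * C₂, fun N x => ?_⟩
  have hr0 : 0 ≤ (N + 1 : ℝ)⁻¹ := by positivity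
  have hr1 : (N + 1 : ℝ)⁻¹ ≤ 1 := inv_le_one_of_one_le₀ (by simp)
  have hlap : |Laplacian.laplacian (cutoff N : EuclideanSpace ℝ (Fin n) → ℝ) x| ≤ C₁ := by
    rw [cutoff_eq_cutoff_zero_smul, laplacian_comp_smul hχ, abs_mul, abs_of_nonneg (by positivity)]
    exact (mul_le_of_le_one_left (abs_nonneg _) (pow_le_one₀ hr0 hr1)).trans (hC₁ _)
  have hrad : |fderiv ℝ (cutoff N) x x| ≤ C₂ := by
    have := hC₂ ((N + 1 : ℝ)⁻¹ • x)
    rw [fderiv_cutoff]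
    simpa using this
  calc _ ≤ |Laplacian.laplacian (cutoff N : EuclideanSpace ℝ (Fin n) → ℝ) x| +
        |2 * fderiv ℝ (cutoff N) x x| := abs_sub _ _
    _ ≤ C₁ + 2 * C₂ := by
      rw [abs_mul, abs_two]
      gcongr

end Cutoff

section GreenFormulas

lemma tendsto_integral_mul_of_tendsto {Ω : Type*} [MeasurableSpace Ω] {μ : Measure Ω}
    {φ : ℕ → Ω → ℝ} {F : Ω → ℝ} {C c : ℝ} (hφ : ∀ N, AEStronglyMeasurable (φ N) μ)
    (hC : ∀ N x, |φ N x| ≤ C) (hlim : ∀ x, Tendsto (φ · x) atTop (𝓝 c)) (hF : Integrable F μ) :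
    Tendsto (fun N => ∫ x, φ N x * F x ∂μ) atTop (𝓝 (c * ∫ x, F x ∂μ)) := by
  rw [← integral_const_mul]
  refine tendsto_integral_of_dominated_convergence (fun x => C * |F x|)
    (fun N => (hφ N).mul hF.1) (hF.abs.const_mul C) (fun N => .of_forall fun x => ?_)
    (.of_forall fun x => (hlim x).mul_const (F x))
  rw [Real.norm_eq_abs, abs_mul]
  gcongr
  exact hC N x

variable {n : ℕ} {f h : EuclideanSpace ℝ (Fin n) → ℝ}

lemma integral_cutoff_mul_norm_sq (hf : ContDiff ℝ 2 f) (hint : Integrable f (gauss n)) (N : ℕ) :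
    ∫ x, cutoff N x * (f x * ‖x‖ ^ 2) ∂gauss n =
      ∫ x, cutoff N x * Laplacian.laplacian f x ∂gauss n + n * ∫ x, cutoff N x * f x ∂gauss n -
        ∫ x, cutoffRemainder N x * f x ∂gauss n := by
  obtain ⟨C, hC⟩ := exists_abs_cutoffRemainder_le n
  have hχ : ContDiff ℝ 2 (cutoff N : EuclideanSpace ℝ (Fin n) → ℝ) := contDiff_cutoff N
  have hc := hasCompactSupport_cutoff (E := EuclideanSpace ℝ (Fin n)) N
  have hcont := hf.continuous
  have hcontχ := hχ.continuous
  have hmom : Integrable (fun x => cutoff N x * (f x * ‖x‖ ^ 2)) (gauss n) :=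
    Continuous.integrable_of_hasCompactSupport (by fun_prop) hc.mul_right
  have hmass : Integrable (fun x => n * (cutoff N x * f x)) (gauss n) :=
    Continuous.integrable_of_hasCompactSupport (by fun_prop) hc.mul_right.mul_left
  have hrem : Integrable (fun x => cutoffRemainder N x * f x) (gauss n) :=
    hint.bdd_mul (continuous_cutoffRemainder N).aestronglyMeasurable (.of_forall (hC N))
  have hgreen : ∫ x, cutoff N x * Laplacian.laplacian f x ∂gauss n =
      ∫ x, f x * (cutoff N x * (‖x‖ ^ 2 - n) + cutoffRemainder N x) ∂gauss n :=
    integral_mul_laplacian_gauss hf hχ hc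
  have hsplit : ∀ x, f x * (cutoff N x * (‖x‖ ^ 2 - n) + cutoffRemainder N x) =
      cutoff N x * (f x * ‖x‖ ^ 2) - n * (cutoff N x * f x) + cutoffRemainder N x * f x :=
    fun x => by ring
  simp_rw [hsplit] at hgreen
  rw [integral_add (by exact hmom.sub hmass) hrem, integral_sub hmom hmass,
    integral_const_mul] at hgreen
  linarith

lemma abs_integral_mul_le_of_abs_le {Ω : Type*} [MeasurableSpace Ω] {μ : Measure Ω} {φ F : Ω → ℝ}
    {C : ℝ} (hC : ∀ x, |φ x| ≤ C) (hF : Integrable F μ) :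
    |∫ x, φ x * F x ∂μ| ≤ C * ∫ x, |F x| ∂μ := by
  rw [← integral_const_mul, ← Real.norm_eq_abs]
  refine norm_integral_le_of_norm_le (hF.abs.const_mul C) (.of_forall fun x => ?_)
  rw [Real.norm_eq_abs, abs_mul]
  gcongr
  exact hC x

lemma integrable_mul_norm_sq_of_laplacian (hh : ContDiff ℝ 2 h) (h0 : ∀ x, 0 ≤ h x)
    (hint : Integrable h (gauss n)) (hlap : Integrable (Laplacian.laplacian h) (gauss n)) :
    Integrable (fun x => h x * ‖x‖ ^ 2) (gauss n) := by
  obtain ⟨C, hC⟩ := exists_abs_cutoffRemainder_le n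
  have hcont : Continuous fun x => h x * ‖x‖ ^ 2 := hh.continuous.mul (by fun_prop)
  have hcover : AECover (gauss n) atTop fun N : ℕ => Metric.closedBall 0 N :=
    aecover_closedBall tendsto_natCast_atTop_atTop
  refine hcover.integrable_of_integral_bounded_of_nonneg_ae
    (1 * ∫ x, |Laplacian.laplacian h x| ∂gauss n + n * (1 * ∫ x, |h x| ∂gauss n) +
      C * ∫ x, |h x| ∂gauss n)
    (fun N => hcont.continuousOn.integrableOn_compact (isCompact_closedBall _ _))
    (.of_forall fun x => mul_nonneg (h0 x) (by positivity)) (.of_forall fun N => ?_)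
  have hnonneg : ∀ x, 0 ≤ cutoff N x * (h x * ‖x‖ ^ 2) := fun x =>
    mul_nonneg (cutoff_nonneg N x) (mul_nonneg (h0 x) (by positivity))
  have hχint : Integrable (fun x => cutoff N x * (h x * ‖x‖ ^ 2)) (gauss n) :=
    (((contDiff_cutoff (k := 2) N).continuous).mul hcont).integrable_of_hasCompactSupport
      (hasCompactSupport_cutoff N).mul_right
  have hgreen := integral_cutoff_mul_norm_sq hh hint N
  have hl := abs_integral_mul_le_of_abs_le (abs_cutoff_le_one N) hlap
  have hm := abs_integral_mul_le_of_abs_le (abs_cutoff_le_one N) hint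
  have hr := abs_integral_mul_le_of_abs_le (hC N) hint
  calc ∫ x in Metric.closedBall 0 N, h x * ‖x‖ ^ 2 ∂gauss n
      = ∫ x in Metric.closedBall 0 N, cutoff N x * (h x * ‖x‖ ^ 2) ∂gauss n := by
        refine setIntegral_congr_fun measurableSet_closedBall fun x hx => ?_
        have := (mem_closedBall_zero_iff.1 hx).trans (lt_add_one (N : ℝ)).le
        rw [cutoff_eq_one this, one_mul]
    _ ≤ ∫ x, cutoff N x * (h x * ‖x‖ ^ 2) ∂gauss n :=
        setIntegral_le_integral hχint (.of_forall hnonneg)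
    _ ≤ _ := by
        rw [hgreen]
        have := mul_le_mul_of_nonneg_left ((le_abs_self _).trans hm) n.cast_nonneg
        linarith [le_abs_self (∫ x, cutoff N x * Laplacian.laplacian h x ∂gauss n),
          neg_abs_le (∫ x, cutoffRemainder N x * h x ∂gauss n)]

lemma integral_laplacian_gauss (hf : ContDiff ℝ 2 f) (hint : Integrable f (gauss n))
    (hmom : Integrable (fun x => f x * ‖x‖ ^ 2) (gauss n))
    (hlap : Integrable (Laplacian.laplacian f) (gauss n)) :
    ∫ x, Laplacian.laplacian f x ∂gauss n =
      ∫ x, f x * ‖x‖ ^ 2 ∂gauss n - n * ∫ x, f x ∂gauss n := by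
  obtain ⟨C, hC⟩ := exists_abs_cutoffRemainder_le n
  have hcutoff {F} (hF : Integrable F (gauss n)) :=
    tendsto_integral_mul_of_tendsto (fun N => (contDiff_cutoff (k := 0) N).continuous
      |>.aestronglyMeasurable) abs_cutoff_le_one tendsto_cutoff hF
  have hrem := tendsto_integral_mul_of_tendsto
    (fun N => (continuous_cutoffRemainder N).aestronglyMeasurable) hC
    (fun x => tendsto_const_nhds.congr' ((cutoffRemainder_eventuallyEq_zero x).mono
      fun _ => Eq.symm)) hint
  have hlim := tendsto_nhds_unique (hcutoff hmom) ((((hcutoff hlap).add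
    ((hcutoff hint).const_mul (n : ℝ))).sub hrem).congr fun N =>
      (integral_cutoff_mul_norm_sq hf hint N).symm)
  linarith

lemma continuous_gradient (hf : ContDiff ℝ 1 f) : Continuous (gradient f) :=
  (LinearIsometryEquiv.continuous _).comp (hf.continuous_fderiv one_ne_zero)

lemma norm_gradient (f : EuclideanSpace ℝ (Fin n) → ℝ) (x : EuclideanSpace ℝ (Fin n)) :
    ‖gradient f x‖ = ‖fderiv ℝ f x‖ :=
  LinearIsometryEquiv.norm_map _ _

lemma integral_laplacian_gauss_eq_integral_fderiv (hf : ContDiff ℝ 2 f)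
    (hgrad : Integrable (fun x => ‖gradient f x‖) (gauss n))
    (hrad : Integrable (fun x => fderiv ℝ f x x) (gauss n))
    (hlap : Integrable (Laplacian.laplacian f) (gauss n)) :
    ∫ x, Laplacian.laplacian f x ∂gauss n = ∫ x, fderiv ℝ f x x ∂gauss n := by
  obtain ⟨C, hC⟩ := exists_norm_fderiv_cutoff_le (E := EuclideanSpace ℝ (Fin n))
  have hχ (N) : ContDiff ℝ 1 (cutoff N : EuclideanSpace ℝ (Fin n) → ℝ) := contDiff_cutoff N
  have hinner_le (N) (x) : ‖inner ℝ (gradient (cutoff N) x) (gradient f x)‖ ≤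
      C / (N + 1) * ‖gradient f x‖ := by
    refine (norm_inner_le_norm _ _).trans ?_
    gcongr
    exact (norm_gradient _ _).trans_le (hC N x)
  have hinner (N) : Integrable (fun x => inner ℝ (gradient (cutoff N) x) (gradient f x))
      (gauss n) :=
    (hgrad.const_mul (C / (N + 1))).mono' ((continuous_gradient (hχ N)).inner
      (continuous_gradient (hf.of_le one_le_two))).aestronglyMeasurable (.of_forall (hinner_le N))
  have hinner_lim : Tendsto (fun N => ∫ x, inner ℝ (gradient (cutoff N) x) (gradient f x) ∂gauss n)
      atTop (𝓝 0) := by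
    refine squeeze_zero_norm (fun N => norm_integral_le_of_norm_le
      (hgrad.const_mul (C / (N + 1))) (.of_forall (hinner_le N))) ?_
    simp_rw [integral_const_mul]
    simpa [div_eq_mul_inv] using ((tendsto_one_div_add_atTop_nhds_zero_nat (𝕜 := ℝ)).const_mul
      C).mul_const (∫ x, ‖gradient f x‖ ∂gauss n)
  have hcutoff {F} (hF : Integrable F (gauss n)) :=
    tendsto_integral_mul_of_tendsto (fun N => (hχ N).continuous.aestronglyMeasurable)
      abs_cutoff_le_one tendsto_cutoff hF
  have hlim := tendsto_nhds_unique (hcutoff hlap) (((hcutoff hrad).sub hinner_lim).congr fun N => by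
    rw [integral_mul_laplacian_gauss_eq_integral_inner hf (hχ N) (hasCompactSupport_cutoff N),
      integral_sub (hrad.bdd_mul (hχ N).continuous.aestronglyMeasurable
        (.of_forall (abs_cutoff_le_one N))) (hinner N)])
  linarith

end GreenFormulas

section RefinedTalagrand

theorem refinedTalagrand {n : ℕ} (hn : 1 ≤ n) : RefinedTalagrand n := by
  intro h hh hC hL
  have : (0 : ℝ) < n := by exact_mod_cast hn
  have hmom := integrable_mul_norm_sq_of_laplacian hC hh.2.1 hh.integrable hL
  rw [integral_laplacian_gauss hC hh.integrable hmom hL, hh.2.2, mul_one]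
  set A := ∫ x, h x * ‖x‖ ^ 2 ∂gauss n with hA
  unfold Ent
  split_ifs with hent
  · rw [hh.2.2, Real.log_one, mul_zero, sub_zero]
    set H := ∫ x, h x * Real.log (h x) ∂gauss n with hH
    have hW := W2_sq_le_entropy hh hent (Real.exp_pos (1 / (2 * n) * (A - n) - 1 / n * H))
    refine hW.trans (le_of_eq ?_)
    rw [← hA, ← hH, Real.log_exp, ← EReal.coe_mul, ← EReal.coe_sub, EReal.exp_coe,
      EReal.coe_ennreal_ofReal, max_eq_left (Real.exp_pos _).le, ← EReal.coe_one,
      ← EReal.coe_sub, ← EReal.coe_natCast, ← EReal.coe_mul, ← EReal.coe_add, EReal.coe_eq_coe_iff]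
    have hopt : n * (1 / 2 - (1 / (2 * n) * (A - n) - 1 / n * H)) + 1 / 2 * A - H = n := by
      field_simp
      ring
    rw [hopt]
    ring
  · have hpos : (0 : ℝ) < 1 / n := by positivity
    rw [EReal.coe_mul_top_of_pos hpos, EReal.sub_top, EReal.exp_bot, EReal.coe_ennreal_zero,
      sub_zero, mul_one, ← EReal.coe_natCast, ← EReal.coe_add]
    refine (W2_sq_le_moment hh hmom).trans (EReal.coe_le_coe ?_)
    rw [← hA]
    linarith

end RefinedTalagrand

section Duality

lemma ofReal_integral_le_lintegral_ofReal {Ω : Type*} [MeasurableSpace Ω] {μ : Measure Ω}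
    {g : Ω → ℝ} (hg : Integrable g μ) :
    ENNReal.ofReal (∫ x, g x ∂μ) ≤ ∫⁻ x, ENNReal.ofReal (g x) ∂μ := by
  rw [integral_eq_lintegral_pos_part_sub_lintegral_neg_part hg]
  exact (ENNReal.ofReal_le_ofReal (sub_le_self _ ENNReal.toReal_nonneg)).trans
    ENNReal.ofReal_toReal_le

lemma ofReal_integral_sub_integral_le_W2_sq {E : Type*} [PseudoEMetricSpace E] [MeasurableSpace E]
    {μ ν : Measure E} {φ ψ : E → ℝ} (hφ : Integrable φ μ) (hψ : Integrable ψ ν)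
    (hle : ∀ x y, ENNReal.ofReal (φ x - ψ y) ≤ edist x y ^ 2 / 2) :
    ENNReal.ofReal (∫ x, φ x ∂μ - ∫ y, ψ y ∂ν) ≤ W2 μ ν ^ 2 := by
  rw [← ENNReal.rpow_natCast, ← ENNReal.rpow_inv_le_iff (by norm_num)]
  refine le_iInf₂ fun π ⟨hfst, hsnd⟩ => ?_
  rw [one_div, Nat.cast_ofNat]
  refine ENNReal.rpow_le_rpow ?_ (by norm_num)
  have hφπ : Integrable (fun p => φ p.1) π :=
    (hfst ▸ hφ : Integrable φ π.fst).comp_measurable measurable_fst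
  have hψπ : Integrable (fun p => ψ p.2) π :=
    (hsnd ▸ hψ : Integrable ψ π.snd).comp_measurable measurable_snd
  have hintφ : ∫ x, φ x ∂μ = ∫ p, φ p.1 ∂π := by
    rw [← hfst, Measure.fst, integral_map measurable_fst.aemeasurable]
    exact (hfst ▸ hφ : Integrable φ π.fst).aestronglyMeasurable
  have hintψ : ∫ y, ψ y ∂ν = ∫ p, ψ p.2 ∂π := by
    rw [← hsnd, Measure.snd, integral_map measurable_snd.aemeasurable]
    exact (hsnd ▸ hψ : Integrable ψ π.snd).aestronglyMeasurable
  rw [hintφ, hintψ, ← integral_sub hφπ hψπ]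
  exact (ofReal_integral_le_lintegral_ofReal (hφπ.sub hψπ)).trans
    (lintegral_mono fun p => hle p.1 p.2)

end Duality

section Linearization

lemma one_add_mul_log_one_add_le {s : ℝ} (hs : |s| ≤ 1 / 2) :
    (1 + s) * Real.log (1 + s) ≤ s + s ^ 2 / 2 + 4 * |s| ^ 3 := by
  have hbounds := abs_le.1 hs
  have hlog : Real.log (1 + s) ≤ s - s ^ 2 / 2 + 2 * |s| ^ 3 := by
    have htaylor := Real.abs_log_sub_add_sum_range_le (x := -s) (by rw [abs_neg]; linarith) 2
    have hrem : |s| ^ 3 / (1 - |s|) ≤ 2 * |s| ^ 3 := by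
      rw [div_le_iff₀ (by linarith)]
      nlinarith [pow_nonneg (abs_nonneg s) 3]
    simp only [Finset.sum_range_succ, Finset.sum_range_zero, abs_neg, sub_neg_eq_add] at htaylor
    norm_num at htaylor
    linarith [(abs_le.1 htaylor).2]
  have hcube : -s ^ 3 ≤ |s| ^ 3 := by
    rw [← abs_pow]
    exact neg_le_abs _
  have hcube' : s * |s| ^ 3 ≤ 1 / 2 * |s| ^ 3 :=
    mul_le_mul_of_nonneg_right hbounds.2 (by positivity)
  nlinarith [mul_le_mul_of_nonneg_left hlog (by linarith : 0 ≤ 1 + s), pow_nonneg (abs_nonneg s) 3]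

variable {Ω : Type*} [MeasurableSpace Ω] {μ : Measure Ω} {F : Ω → ℝ} {B ε : ℝ}

lemma isProbDensity_one_add_mul [IsProbabilityMeasure μ] (hF : Measurable F)
    (hint : Integrable F μ) (hmean : ∫ x, F x ∂μ = 0) (hbound : ∀ x, |ε * F x| ≤ 1) :
    IsProbDensity μ fun x => 1 + ε * F x := by
  refine ⟨by fun_prop, fun x => by linarith [(abs_le.1 (hbound x)).1], ?_⟩
  rw [integral_add (integrable_const _) (hint.const_mul ε), integral_const_mul, hmean]
  simp

lemma integral_one_add_mul_log_le [IsFiniteMeasure μ] (hF : Measurable F)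
    (hB : ∀ x, |F x| ≤ B) (hmean : ∫ x, F x ∂μ = 0) (hε : 0 ≤ ε) (hεB : ε * B ≤ 1 / 2) :
    Integrable (fun x => (1 + ε * F x) * Real.log (1 + ε * F x)) μ ∧
      ∫ x, (1 + ε * F x) * Real.log (1 + ε * F x) ∂μ ≤
        (ε ^ 2 / 2 + 4 * ε ^ 3 * B) * ∫ x, F x ^ 2 ∂μ := by
  have hF2 : MemLp F 2 μ := MemLp.of_bound hF.aestronglyMeasurable B (.of_forall hB)
  have hsmall : ∀ x, |ε * F x| ≤ 1 / 2 := fun x => by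
    rw [abs_mul, abs_of_nonneg hε]
    exact (mul_le_mul_of_nonneg_left (hB x) hε).trans hεB
  have hpoint : ∀ x, (1 + ε * F x) * Real.log (1 + ε * F x) ≤
      ε * F x + (ε ^ 2 / 2 + 4 * ε ^ 3 * B) * F x ^ 2 := fun x => by
    have hcube : |ε * F x| ^ 3 ≤ ε ^ 3 * B * F x ^ 2 := by
      rw [abs_mul, abs_of_nonneg hε, mul_pow, mul_assoc, ← sq_abs (F x), pow_succ' |F x|]
      gcongr
      exact hB x
    linarith [one_add_mul_log_one_add_le (hsmall x)]
  have hmajor : Integrable (fun x => ε * F x + (ε ^ 2 / 2 + 4 * ε ^ 3 * B) * F x ^ 2) μ :=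
    ((hF2.integrable one_le_two).const_mul _).add (hF2.integrable_sq.const_mul _)
  have hent : Integrable (fun x => (1 + ε * F x) * Real.log (1 + ε * F x)) μ := by
    refine integrable_of_le_of_le (by fun_prop) (.of_forall fun x => neg_one_le_mul_log ?_)
      (.of_forall hpoint) (integrable_const (-1)) hmajor
    linarith [(abs_le.1 (hsmall x)).1]
  refine ⟨hent, (integral_mono hent hmajor hpoint).trans_eq ?_⟩
  rw [integral_add ((hF2.integrable one_le_two).const_mul _) (hF2.integrable_sq.const_mul _),
    integral_const_mul, integral_const_mul, hmean, mul_zero, zero_add]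

end Linearization

section CompactSupport

lemma RefinedTalagrand.W2_sq_le_entropy {n : ℕ} (H : RefinedTalagrand n) (hn : 1 ≤ n)
    {h : EuclideanSpace ℝ (Fin n) → ℝ} (hh : IsProbDensity (gauss n) h) (hC : ContDiff ℝ 2 h)
    (hlap : Integrable (Laplacian.laplacian h) (gauss n))
    (hent : Integrable (fun x => h x * Real.log (h x)) (gauss n)) :
    W2 (densMeasure (gauss n) h) (gauss n) ^ 2 ≤
      ENNReal.ofReal (∫ x, h x * Real.log (h x) ∂gauss n) := by
  have : (0 : ℝ) < n := by exact_mod_cast hn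
  rw [← EReal.coe_ennreal_le_coe_ennreal_iff]
  refine (H h hh hC hlap).trans ?_
  set A := ∫ x, Laplacian.laplacian h x ∂gauss n
  rw [Ent, if_pos hent, hh.2.2, Real.log_one, mul_zero, sub_zero]
  set S := ∫ x, h x * Real.log (h x) ∂gauss n
  set t := 1 / (2 * n) * A - 1 / n * S with ht
  have hexp : 1 / 2 * A + n * (1 - Real.exp t) ≤ S := by
    have hS : S = 1 / 2 * A - n * t := by
      rw [ht]
      field_simp
      ring
    nlinarith [Real.add_one_le_exp t]
  rw [← EReal.coe_mul, ← EReal.coe_sub, EReal.exp_coe, EReal.coe_ennreal_ofReal,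
    max_eq_left (Real.exp_pos _).le, ← EReal.coe_one, ← EReal.coe_sub, ← EReal.coe_natCast,
    ← EReal.coe_mul, ← EReal.coe_add, EReal.coe_ennreal_ofReal, EReal.coe_le_coe_iff]
  exact hexp.trans (le_max_left S 0)

variable {E : Type*} [NormedAddCommGroup E] [NormedSpace ℝ E] {f : E → ℝ} {K : NNReal}

lemma sub_le_norm_fderiv_mul_add (hf : Differentiable ℝ f)
    (hK : LipschitzWith K (fderiv ℝ f)) (x y : E) :
    f x - f y ≤ ‖fderiv ℝ f y‖ * ‖x - y‖ + K * ‖x - y‖ ^ 2 := by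
  have hremainder : ‖f x - f y - fderiv ℝ f y (x - y)‖ ≤ K * ‖x - y‖ * ‖x - y‖ := by
    refine (convex_segment y x).norm_image_sub_le_of_norm_hasFDerivWithin_le'
      (fun z _ => (hf z).hasFDerivAt.hasFDerivWithinAt) (fun z hz => ?_)
      (left_mem_segment ℝ y x) (right_mem_segment ℝ y x)
    refine (hK.norm_sub_le z y).trans ?_
    gcongr
    exact norm_sub_le_of_mem_segment hz
  have hlin := (fderiv ℝ f y).le_opNorm (x - y)
  rw [Real.norm_eq_abs] at hremainder hlin
  linarith [(abs_le.1 hremainder).2, (abs_le.1 hlin).2]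

lemma ofReal_linearization_le_W2_sq [MeasurableSpace E] {μ ν : Measure E}
    (hf : Differentiable ℝ f) (hK : LipschitzWith K (fderiv ℝ f)) (hμ : Integrable f μ)
    (hν : Integrable f ν) (hD : Integrable (fun x => ‖fderiv ℝ f x‖ ^ 2) ν) {ε : ℝ} (hε : 0 ≤ ε)
    (hεK : 2 * ε * K < 1) :
    ENNReal.ofReal (ε * (∫ x, f x ∂μ - ∫ x, f x ∂ν) -
      ε ^ 2 / (2 * (1 - 2 * ε * K)) * ∫ x, ‖fderiv ℝ f x‖ ^ 2 ∂ν) ≤ W2 μ ν ^ 2 := by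
  set c := 1 - 2 * ε * K with hc
  have hcpos : 0 < c := by linarith
  have hpotential := ofReal_integral_sub_integral_le_W2_sq (hμ.const_mul ε)
    ((hν.const_mul ε).add (hD.const_mul (ε ^ 2 / (2 * c)))) fun x y => by
      rw [edist_sq_div_two]
      refine ENNReal.ofReal_le_ofReal ?_
      have hyoung : ε * ‖fderiv ℝ f y‖ * ‖x - y‖ ≤
          ε ^ 2 / (2 * c) * ‖fderiv ℝ f y‖ ^ 2 + c / 2 * ‖x - y‖ ^ 2 := by
        have hsq : 0 ≤ (ε * ‖fderiv ℝ f y‖ - c * ‖x - y‖) ^ 2 / (2 * c) := by positivity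
        have hexpand : (ε * ‖fderiv ℝ f y‖ - c * ‖x - y‖) ^ 2 / (2 * c) =
            ε ^ 2 / (2 * c) * ‖fderiv ℝ f y‖ ^ 2 + c / 2 * ‖x - y‖ ^ 2 -
              ε * ‖fderiv ℝ f y‖ * ‖x - y‖ := by
          field_simp
          ring
        linarith
      have hsub := mul_le_mul_of_nonneg_left (sub_le_norm_fderiv_mul_add hf hK x y) hε
      simp only [Pi.add_apply]
      rw [hc] at hyoung ⊢
      linarith
  refine le_trans (ENNReal.ofReal_le_ofReal (le_of_eq ?_)) hpotential
  simp only [Pi.add_apply]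
  rw [integral_add (hν.const_mul ε) (hD.const_mul _), integral_const_mul, integral_const_mul,
    integral_const_mul]
  ring

variable {n : ℕ} {f : EuclideanSpace ℝ (Fin n) → ℝ} {B ε : ℝ}

lemma laplacian_const_add_mul (hf : ContDiff ℝ 2 f) (a b : ℝ) (x : EuclideanSpace ℝ (Fin n)) :
    Laplacian.laplacian (fun y => a + b * f y) x = b * Laplacian.laplacian f x := by
  change Laplacian.laplacian ((fun _ => a : EuclideanSpace ℝ (Fin n) → ℝ) + b • f) x = _
  rw [ContDiffAt.laplacian_add (f₂ := b • f) contDiffAt_const (hf.contDiffAt.const_smul b),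
    InnerProductSpace.laplacian_smul b hf.contDiffAt, InnerProductSpace.laplacian_const]
  simp

lemma RefinedTalagrand.integral_sq_mul_le (H : RefinedTalagrand n) (hn : 1 ≤ n)
    (hf : ContDiff ℝ 2 f) (hlap : Integrable (Laplacian.laplacian f) (gauss n)) {K : NNReal}
    (hK : LipschitzWith K (fderiv ℝ f)) (hD : Integrable (fun x => ‖fderiv ℝ f x‖ ^ 2) (gauss n))
    (hB : ∀ x, |f x| ≤ B) (hmean : ∫ x, f x ∂gauss n = 0) (hε : 0 < ε) (hεK : 2 * ε * K < 1)
    (hεB : ε * B ≤ 1 / 2) :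
    (1 - 8 * ε * B) * ∫ x, f x ^ 2 ∂gauss n ≤
      (∫ x, ‖fderiv ℝ f x‖ ^ 2 ∂gauss n) / (1 - 2 * ε * K) := by
  have hfm : Measurable f := hf.continuous.measurable
  have hf2 : MemLp f 2 (gauss n) := MemLp.of_bound hfm.aestronglyMeasurable B (.of_forall hB)
  have hfint : Integrable f (gauss n) := hf2.integrable one_le_two
  obtain ⟨hent, hentle⟩ := integral_one_add_mul_log_le hfm hB hmean hε.le hεB
  have hh : IsProbDensity (gauss n) fun x => 1 + ε * f x :=
    isProbDensity_one_add_mul hfm hfint hmean fun x => by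
      rw [abs_mul, abs_of_pos hε]
      linarith [mul_le_mul_of_nonneg_left (hB x) hε.le]
  have hsplit : ∀ x, (1 + ε * f x) * f x = f x + ε * f x ^ 2 := fun x => by ring
  have hmul : Integrable (fun x => (1 + ε * f x) * f x) (gauss n) := by
    simp_rw [hsplit]
    exact hfint.add (hf2.integrable_sq.const_mul ε)
  have hmeanh : ∫ x, f x ∂densMeasure (gauss n) (fun x => 1 + ε * f x) =
      ε * ∫ x, f x ^ 2 ∂gauss n := by
    rw [integral_densMeasure hh.1 hh.2.1]
    simp_rw [hsplit]
    rw [integral_add hfint (hf2.integrable_sq.const_mul ε), hmean, integral_const_mul, zero_add]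
  have hlaph : Integrable (Laplacian.laplacian fun x => 1 + ε * f x) (gauss n) :=
    (hlap.const_mul ε).congr (.of_forall fun x => (laplacian_const_add_mul hf 1 ε x).symm)
  have hdual := (ofReal_linearization_le_W2_sq (hf.differentiable two_ne_zero) hK
    ((integrable_densMeasure_iff hh.1 hh.2.1).2 hmul) hfint hD hε.le hεK).trans
    (H.W2_sq_le_entropy hn hh (contDiff_const.add (contDiff_const.mul hf)) hlaph hent)
  have : 0 ≤ ∫ x, f x ^ 2 ∂gauss n := integral_nonneg fun x => sq_nonneg _
  have hB0 : 0 ≤ B := (abs_nonneg _).trans (hB 0)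
  have hreal := (ENNReal.ofReal_le_ofReal_iff (by positivity)).1
    (hdual.trans (ENNReal.ofReal_le_ofReal hentle))
  rw [hmeanh, hmean, sub_zero] at hreal
  have hc : 0 < 1 - 2 * ε * K := by linarith
  rw [le_div_iff₀ hc]
  rw [div_mul_eq_mul_div, sub_le_iff_le_add, ← sub_le_iff_le_add', le_div_iff₀ (by positivity)]
    at hreal
  refine le_of_mul_le_mul_left ?_ (by positivity : 0 < ε ^ 2)
  linarith

lemma RefinedTalagrand.integral_sq_le (H : RefinedTalagrand n) (hn : 1 ≤ n)
    (hf : ContDiff ℝ 2 f) (hlap : Integrable (Laplacian.laplacian f) (gauss n)) {K : NNReal}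
    (hK : LipschitzWith K (fderiv ℝ f)) (hD : Integrable (fun x => ‖fderiv ℝ f x‖ ^ 2) (gauss n))
    (hB : ∀ x, |f x| ≤ B) (hmean : ∫ x, f x ∂gauss n = 0) :
    ∫ x, f x ^ 2 ∂gauss n ≤ ∫ x, ‖fderiv ℝ f x‖ ^ 2 ∂gauss n := by
  have hlim (g : ℝ → ℝ) (hg : ContinuousAt g 0) : Tendsto g (𝓝[>] 0) (𝓝 (g 0)) :=
    hg.tendsto.mono_left nhdsWithin_le_nhds
  have hleft := hlim (fun ε => (1 - 8 * ε * B) * ∫ x, f x ^ 2 ∂gauss n) (by fun_prop)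
  have hright := hlim (fun ε => (∫ x, ‖fderiv ℝ f x‖ ^ 2 ∂gauss n) / (1 - 2 * ε * K))
    (by fun_prop (disch := simp))
  have hKsmall : ∀ᶠ ε : ℝ in 𝓝[>] 0, 2 * ε * K < 1 :=
    (hlim (fun ε => 2 * ε * K) (by fun_prop)).eventually_lt_const (by simp)
  have hBsmall : ∀ᶠ ε : ℝ in 𝓝[>] 0, ε * B < 1 / 2 :=
    (hlim (fun ε => ε * B) (by fun_prop)).eventually_lt_const (by simp)
  simp only [mul_zero, zero_mul, sub_zero, one_mul, div_one] at hleft hright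
  refine le_of_tendsto_of_tendsto hleft hright ?_
  filter_upwards [self_mem_nhdsWithin, hKsmall, hBsmall] with ε hε hεK hεB
  exact H.integral_sq_mul_le hn hf hlap hK hD hB hmean hε hεK hεB.le

lemma RefinedTalagrand.variance_le_of_bounded (H : RefinedTalagrand n) (hn : 1 ≤ n)
    (hf : ContDiff ℝ 2 f) (hlap : Integrable (fun x => Laplacian.laplacian f x) (gauss n))
    (hK : LipschitzWith K (fderiv ℝ f))
    (hD : Integrable (fun x => ‖fderiv ℝ f x‖ ^ 2) (gauss n)) (hB : ∀ x, |f x| ≤ B) :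
    Var[f; gauss n] ≤ ∫ x, ‖fderiv ℝ f x‖ ^ 2 ∂gauss n := by
  have hfint : Integrable f (gauss n) :=
    .of_bound hf.continuous.aestronglyMeasurable B (.of_forall hB)
  obtain ⟨m, hm⟩ : ∃ m, m = ∫ x, f x ∂gauss n := ⟨_, rfl⟩
  have hfderiv : fderiv ℝ (fun x => -m + 1 * f x) = fderiv ℝ f := by
    ext x : 1
    simp only [one_mul, fderiv_const_add]
  have hlapm : Integrable (Laplacian.laplacian fun x => -m + 1 * f x) (gauss n) :=
    (hlap.const_mul 1).congr (.of_forall fun x => (laplacian_const_add_mul hf (-m) 1 x).symm)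
  have hmean : ∫ x, (-m + 1 * f x) ∂gauss n = 0 := by
    rw [integral_add (integrable_const _) (hfint.const_mul 1), integral_const_mul, ← hm]
    simp
  have hbound (x) : |-m + 1 * f x| ≤ |m| + B := by
    rw [one_mul, ← abs_neg m]
    exact (abs_add_le _ _).trans (by gcongr; exact hB x)
  have hpoincare := H.integral_sq_le hn (contDiff_const.add (contDiff_const.mul hf)) hlapm
    (hfderiv.symm ▸ hK) (by rwa [hfderiv]) hbound hmean
  rw [hfderiv] at hpoincare
  rw [variance_eq_integral hf.continuous.aemeasurable, ← hm]
  simpa only [one_mul, neg_add_eq_sub] using hpoincare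

lemma RefinedTalagrand.variance_le_of_hasCompactSupport (H : RefinedTalagrand n) (hn : 1 ≤ n)
    (hf : ContDiff ℝ 2 f) (hc : HasCompactSupport f) :
    Var[f; gauss n] ≤ ∫ x, ‖fderiv ℝ f x‖ ^ 2 ∂gauss n := by
  have hf' : ContDiff ℝ 1 (fderiv ℝ f) := hf.fderiv_right (by norm_num)
  obtain ⟨M, hM⟩ := hc.exists_bound_of_continuous hf.continuous
  obtain ⟨K, hK⟩ := ContDiff.lipschitzWith_of_hasCompactSupport (hc.fderiv ℝ) hf' one_ne_zero
  have hD : Integrable (fun x => ‖fderiv ℝ f x‖ ^ 2) (gauss n) := by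
    refine (hf'.continuous.norm.pow 2).integrable_of_hasCompactSupport ?_
    exact (hc.fderiv ℝ).mono fun x hx => by simpa using hx
  have hlap : Integrable (fun x => Laplacian.laplacian f x) (gauss n) :=
    (continuous_laplacian hf).integrable_of_hasCompactSupport (hasCompactSupport_laplacian hc)
  exact H.variance_le_of_bounded hn hf hlap hK hD hM

end CompactSupport

section VarianceLimit

variable {Ω : Type*} [MeasurableSpace Ω] {μ : Measure Ω} [IsProbabilityMeasure μ] {X : Ω → ℝ}

lemma lintegral_enorm_sub_sq_prod (hX : MemLp X 2 μ) :
    ∫⁻ p, ‖X p.1 - X p.2‖ₑ ^ 2 ∂μ.prod μ = ENNReal.ofReal (2 * Var[X; μ]) := by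
  have hfst := hX.comp_fst μ
  have hsnd := hX.comp_snd μ
  have hmean : ∫ p, (X p.1 - X p.2) ∂μ.prod μ = 0 := by
    rw [integral_sub (hfst.integrable one_le_two) (hsnd.integrable one_le_two),
      integral_fun_fst, integral_fun_snd, sub_self]
  have hvar : Var[fun p : Ω × Ω => X p.1 - X p.2; μ.prod μ] = 2 * Var[X; μ] := by
    rw [two_mul]
    nth_rw 3 [← variance_neg]
    simpa only [sub_eq_add_neg, Pi.neg_apply] using variance_add_prod hX hX.neg
  have hsub : MemLp (fun p : Ω × Ω => X p.1 - X p.2) 2 (μ.prod μ) := hfst.sub hsnd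
  rw [← hvar, hsub.ofReal_variance_eq, evariance, hmean]
  simp_rw [sub_zero]

lemma memLp_two_of_lintegral_enorm_sub_sq_ne_top (hX : Measurable X)
    (hfin : ∫⁻ p, ‖X p.1 - X p.2‖ₑ ^ 2 ∂μ.prod μ ≠ ∞) : MemLp X 2 μ := by
  have hmeas : Measurable fun p : Ω × Ω => ‖X p.1 - X p.2‖ₑ ^ 2 := by fun_prop
  rw [lintegral_prod_symm _ hmeas.aemeasurable] at hfin
  obtain ⟨y, hy⟩ := (ae_lt_top hmeas.lintegral_prod_left' hfin).exists
  have hsub : MemLp (fun x => X x - X y) 2 μ := by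
    rw [memLp_two_iff_integrable_sq (hX.sub_const _).aestronglyMeasurable]
    refine ⟨((hX.sub_const _).pow_const 2).aestronglyMeasurable, ?_⟩
    simpa only [hasFiniteIntegral_iff_enorm, enorm_pow] using hy
  simpa only [Pi.add_def, sub_add_cancel] using hsub.add (memLp_const (X y))

lemma integral_add_const_sq (hX : MemLp X 2 μ) (c : ℝ) :
    ∫ x, (X x + c) ^ 2 ∂μ = ∫ x, X x ^ 2 ∂μ + 2 * c * ∫ x, X x ∂μ + c ^ 2 := by
  have hcross := (hX.integrable one_le_two).const_mul (2 * c)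
  have hsum : Integrable (fun x => X x ^ 2 + 2 * c * X x) μ := hX.integrable_sq.add hcross
  calc ∫ x, (X x + c) ^ 2 ∂μ = ∫ x, (X x ^ 2 + 2 * c * X x + c ^ 2) ∂μ := by
        congr with x
        ring
    _ = ∫ x, X x ^ 2 ∂μ + 2 * c * ∫ x, X x ∂μ + c ^ 2 := by
        rw [integral_add hsum (integrable_const _), integral_add hX.integrable_sq hcross,
          integral_const_mul, integral_const, probReal_univ, one_smul]

lemma memLp_two_and_variance_le_of_tendsto {Y : ℕ → Ω → ℝ} {v : ℕ → ℝ} {V : ℝ}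
    (hm : ∀ N, Measurable (Y N)) (hY : ∀ N, MemLp (Y N) 2 μ)
    (hlim : ∀ x, Tendsto (Y · x) atTop (𝓝 (X x)))
    (hvar : ∀ N, Var[Y N; μ] ≤ v N) (hv : Tendsto v atTop (𝓝 V)) :
    MemLp X 2 μ ∧ Var[X; μ] ≤ V := by
  have hV : 0 ≤ V := ge_of_tendsto' hv fun N => (variance_nonneg _ _).trans (hvar N)
  have hfatou : ∫⁻ p, ‖X p.1 - X p.2‖ₑ ^ 2 ∂μ.prod μ ≤ ENNReal.ofReal (2 * V) := by
    calc ∫⁻ p, ‖X p.1 - X p.2‖ₑ ^ 2 ∂μ.prod μ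
        = ∫⁻ p, liminf (fun N => ‖Y N p.1 - Y N p.2‖ₑ ^ 2) atTop ∂μ.prod μ :=
          lintegral_congr fun p => (((ENNReal.continuous_pow 2).tendsto _).comp
            ((hlim p.1).sub (hlim p.2)).enorm).liminf_eq.symm
      _ ≤ liminf (fun N => ∫⁻ p, ‖Y N p.1 - Y N p.2‖ₑ ^ 2 ∂μ.prod μ) atTop :=
          lintegral_liminf_le fun N => by have := hm N; fun_prop
      _ ≤ liminf (fun N => ENNReal.ofReal (2 * v N)) atTop := by
          refine liminf_le_liminf (.of_forall fun N => ?_)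
          rw [lintegral_enorm_sub_sq_prod (hY N)]
          gcongr
          exact hvar N
      _ = ENNReal.ofReal (2 * V) := (ENNReal.tendsto_ofReal (hv.const_mul 2)).liminf_eq
  have hX : MemLp X 2 μ := memLp_two_of_lintegral_enorm_sub_sq_ne_top
    (measurable_of_tendsto_metrizable hm (tendsto_pi_nhds.2 hlim))
    (hfatou.trans_lt ENNReal.ofReal_lt_top).ne
  rw [lintegral_enorm_sub_sq_prod hX, ENNReal.ofReal_le_ofReal_iff (by positivity)] at hfatou
  exact ⟨hX, by linarith⟩

end VarianceLimit

section Truncation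

/-- A bounded smooth approximation of the identity of the line with derivative in `(0, 1]`. -/
def arctanTrunc (N : ℕ) (u : ℝ) : ℝ :=
  (N + 1) * Real.arctan (u / (N + 1))

lemma hasDerivAt_arctanTrunc (N : ℕ) (u : ℝ) :
    HasDerivAt (arctanTrunc N) (1 / (1 + (u / (N + 1)) ^ 2)) u := by
  refine ((((hasDerivAt_id u).div_const (N + 1 : ℝ)).arctan).const_mul (N + 1 : ℝ)).congr_deriv ?_
  simp only [id]
  field_simp

lemma contDiff_arctanTrunc {k : WithTop ℕ∞} (N : ℕ) : ContDiff ℝ k (arctanTrunc N) :=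
  contDiff_const.mul (Real.contDiff_arctan.comp (contDiff_id.div_const _))

lemma abs_arctanTrunc_le (N : ℕ) (u : ℝ) : |arctanTrunc N u| ≤ (N + 1) * (Real.pi / 2) := by
  rw [arctanTrunc, abs_mul, abs_of_nonneg (by positivity : (0 : ℝ) ≤ N + 1)]
  gcongr
  exact abs_le.2 ⟨(Real.neg_pi_div_two_lt_arctan _).le, (Real.arctan_lt_pi_div_two _).le⟩

lemma tendsto_arctanTrunc (u : ℝ) : Tendsto (arctanTrunc · u) atTop (𝓝 u) := by
  have hderiv : HasDerivAt (fun s : ℝ => Real.arctan (s * u)) u 0 := by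
    simpa using ((hasDerivAt_id (0 : ℝ)).mul_const u).arctan
  have hzero : Tendsto (fun N : ℕ => 1 / ((N : ℝ) + 1)) atTop (𝓝[≠] 0) :=
    tendsto_nhdsWithin_iff.2 ⟨tendsto_one_div_add_atTop_nhds_zero_nat,
      .of_forall fun N => (by positivity : 1 / ((N : ℝ) + 1) ≠ 0)⟩
  refine (hderiv.tendsto_slope_zero.comp hzero).congr fun N => ?_
  simp [arctanTrunc, div_eq_inv_mul]

variable {E : Type*} [NormedAddCommGroup E] [InnerProductSpace ℝ E] {f : E → ℝ}

/-- Truncation of `f` in both the values and the variable. The values grow like `N`, so the cut-off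
is taken at radius of order `N ^ 2` to make its contribution to the gradient vanish. -/
def truncation (f : E → ℝ) (N : ℕ) (x : E) : ℝ :=
  cutoff ((N + 1) ^ 2) x * arctanTrunc N (f x)

lemma tendsto_truncation (f : E → ℝ) (x : E) :
    Tendsto (truncation f · x) atTop (𝓝 (f x)) := by
  have hsq : Tendsto (fun N : ℕ => (N + 1) ^ 2) atTop atTop :=
    (tendsto_pow_atTop two_ne_zero).comp (tendsto_add_atTop_nat 1)
  simpa only [one_mul] using! ((tendsto_cutoff x).comp hsq).mul (tendsto_arctanTrunc (f x))

lemma contDiff_truncation {k : ℕ∞} (hf : ContDiff ℝ k f) (N : ℕ) :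
    ContDiff ℝ k (truncation f N) :=
  (contDiff_cutoff _).mul ((contDiff_arctanTrunc N).comp hf)

lemma hasCompactSupport_truncation [FiniteDimensional ℝ E] (f : E → ℝ) (N : ℕ) :
    HasCompactSupport (truncation f N) :=
  (hasCompactSupport_cutoff _).mul_right

lemma exists_norm_fderiv_truncation_le (E : Type*) [NormedAddCommGroup E] [InnerProductSpace ℝ E]
    [FiniteDimensional ℝ E] : ∃ C, ∀ {f : E → ℝ}, Differentiable ℝ f → ∀ (N : ℕ) (x : E),
      ‖fderiv ℝ (truncation f N) x‖ ≤ ‖fderiv ℝ f x‖ + C / (N + 1) := by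
  obtain ⟨C, hC⟩ := exists_norm_fderiv_cutoff_le (E := E)
  refine ⟨Real.pi / 2 * C, fun {f} hf N x => ?_⟩
  have hC0 : 0 ≤ C := by simpa using (norm_nonneg _).trans (hC 0 0)
  have hderiv := ((contDiff_cutoff (k := 1) ((N + 1) ^ 2)).differentiable one_ne_zero
    x).hasFDerivAt.mul ((hasDerivAt_arctanTrunc N (f x)).comp_hasFDerivAt x (hf x).hasFDerivAt)
  have hslope : |1 / (1 + (f x / (N + 1)) ^ 2)| ≤ 1 := by
    rw [abs_of_nonneg (by positivity), div_le_one (by positivity)]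
    exact le_add_of_nonneg_right (sq_nonneg _)
  have hcut : C / (((N + 1) ^ 2 : ℕ) + 1) ≤ C / ((N + 1 : ℝ) ^ 2) := by
    push_cast
    gcongr
    exact le_add_of_nonneg_right zero_le_one
  rw [show fderiv ℝ (truncation f N) x = _ from hderiv.fderiv]
  calc _ ≤ |cutoff ((N + 1) ^ 2) x| * (|1 / (1 + (f x / (N + 1)) ^ 2)| * ‖fderiv ℝ f x‖) +
          |arctanTrunc N (f x)| * ‖fderiv ℝ (cutoff ((N + 1) ^ 2)) x‖ := by
        refine (norm_add_le _ _).trans_eq ?_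
        simp only [norm_smul, Real.norm_eq_abs, Function.comp_apply]
    _ ≤ 1 * (1 * ‖fderiv ℝ f x‖) + (N + 1) * (Real.pi / 2) * (C / (N + 1) ^ 2) := by
        gcongr
        · exact abs_cutoff_le_one _ _
        · exact abs_arctanTrunc_le _ _
        · exact (hC _ x).trans hcut
    _ = ‖fderiv ℝ f x‖ + Real.pi / 2 * C / (N + 1) := by
        field_simp

end Truncation

section Poincare

variable {n : ℕ} {f : EuclideanSpace ℝ (Fin n) → ℝ}

lemma RefinedTalagrand.memLp_two_and_variance_le (H : RefinedTalagrand n) (hn : 1 ≤ n)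
    (hf : ContDiff ℝ 2 f) (hD : Integrable (fun x => ‖fderiv ℝ f x‖ ^ 2) (gauss n)) :
    MemLp f 2 (gauss n) ∧ Var[f; gauss n] ≤ ∫ x, ‖fderiv ℝ f x‖ ^ 2 ∂gauss n := by
  obtain ⟨C, hC⟩ := exists_norm_fderiv_truncation_le (EuclideanSpace ℝ (Fin n))
  have hT (N) : ContDiff ℝ 2 (truncation f N) := contDiff_truncation hf N
  have hfderiv : MemLp (fun x => ‖fderiv ℝ f x‖) 2 (gauss n) :=
    (memLp_two_iff_integrable_sq
      (hf.continuous_fderiv two_ne_zero).norm.aestronglyMeasurable).2 hD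
  refine memLp_two_and_variance_le_of_tendsto (Y := truncation f)
    (v := fun N => ∫ x, (‖fderiv ℝ f x‖ + C / (N + 1)) ^ 2 ∂gauss n)
    (fun N => (hT N).continuous.measurable)
    (fun N => (hT N).continuous.memLp_of_hasCompactSupport (hasCompactSupport_truncation f N))
    (tendsto_truncation f) (fun N => ?_) ?_
  · refine (H.variance_le_of_hasCompactSupport hn (hT N) (hasCompactSupport_truncation f N)).trans
      (integral_mono_of_nonneg (.of_forall fun x => sq_nonneg _)
        (hfderiv.add (memLp_const _)).integrable_sq (.of_forall fun x => ?_))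
    dsimp only
    gcongr
    exact hC (hf.differentiable two_ne_zero) N x
  · have hδ : Tendsto (fun N : ℕ => C / ((N : ℝ) + 1)) atTop (𝓝 0) := by
      simpa [div_eq_mul_inv] using tendsto_one_div_add_atTop_nhds_zero_nat.const_mul C
    simp_rw [integral_add_const_sq hfderiv]
    simpa using ((((hδ.const_mul 2).mul_const (∫ x, ‖fderiv ℝ f x‖ ∂gauss n)).const_add
      (∫ x, ‖fderiv ℝ f x‖ ^ 2 ∂gauss n)).add (hδ.pow 2))

end Poincare

section RefinedPoincare

variable {n : ℕ} {f : EuclideanSpace ℝ (Fin n) → ℝ}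

lemma memLp_two_norm_sq_gauss :
    MemLp (fun x : EuclideanSpace ℝ (Fin n) => ‖x‖ ^ 2) 2 (gauss n) := by
  rw [memLp_two_iff_integrable_sq (by fun_prop)]
  simpa only [id, ← pow_mul] using
    (IsGaussian.memLp_id (gauss n) 4 (by simp)).integrable_norm_pow (p := 4) (by norm_num)

lemma gradient_sub_const_mul_norm_sq {x : EuclideanSpace ℝ (Fin n)} (hf : DifferentiableAt ℝ f x)
    (a : ℝ) : gradient (fun y => f y - a * ‖y‖ ^ 2) x = gradient f x - (2 * a) • x := by
  refine ext_inner_right ℝ fun v => ?_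
  have hderiv := hf.hasFDerivAt.sub ((hasStrictFDerivAt_norm_sq x).hasFDerivAt.const_mul a)
  rw [inner_gradient_left, inner_sub_left, inner_gradient_left, inner_smul_left,
    show fderiv ℝ (fun y => f y - a * ‖y‖ ^ 2) x = _ from hderiv.fderiv]
  simp
  ring

lemma laplacian_norm_sq (x : EuclideanSpace ℝ (Fin n)) :
    Laplacian.laplacian (fun y : EuclideanSpace ℝ (Fin n) => ‖y‖ ^ 2) x = 2 * n := by
  have hpartial (i : Fin n) :
      partialDeriv i (fun y : EuclideanSpace ℝ (Fin n) => ‖y‖ ^ 2) = fun y => 2 * y i := by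
    ext y
    rw [partialDeriv, (hasStrictFDerivAt_norm_sq y).hasFDerivAt.fderiv]
    simp [EuclideanSpace.inner_single_right]
  have hcoord (i : Fin n) : partialDeriv i (fun y => 2 * y i) x = 2 := by
    have hderiv : HasFDerivAt (fun y : EuclideanSpace ℝ (Fin n) => 2 * y i) _ x :=
      (EuclideanSpace.proj i : EuclideanSpace ℝ (Fin n) →L[ℝ] ℝ).hasFDerivAt.const_mul 2
    rw [partialDeriv, hderiv.fderiv]
    simp
  rw [laplacian_eq_sum_partialDeriv (contDiff_norm_sq ℝ)]
  simp_rw [hpartial, hcoord]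
  simp [mul_comm]

lemma covariance_norm_sq_gauss (hf : ContDiff ℝ 2 f) (hf2 : MemLp f 2 (gauss n))
    (hlap : Integrable (Laplacian.laplacian f) (gauss n)) :
    cov[f, fun x => ‖x‖ ^ 2; gauss n] = ∫ x, Laplacian.laplacian f x ∂gauss n := by
  rw [covariance_eq_sub hf2 memLp_two_norm_sq_gauss, integral_norm_sq_gauss,
    integral_laplacian_gauss hf (hf2.integrable one_le_two)
      (hf2.integrable_mul memLp_two_norm_sq_gauss) hlap, mul_comm (n : ℝ)]
  rfl

lemma variance_norm_sq_gauss : Var[fun x => ‖x‖ ^ 2; gauss n] = 2 * n := by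
  have hlap : Laplacian.laplacian (fun x : EuclideanSpace ℝ (Fin n) => ‖x‖ ^ 2) =
      fun _ => (2 * n : ℝ) := funext laplacian_norm_sq
  rw [← covariance_self (by fun_prop), covariance_norm_sq_gauss (contDiff_norm_sq ℝ)
    memLp_two_norm_sq_gauss (by rw [hlap]; exact integrable_const _), hlap]
  simp

lemma variance_sub_const_mul_norm_sq_gauss (hf : ContDiff ℝ 2 f) (hf2 : MemLp f 2 (gauss n))
    (hlap : Integrable (Laplacian.laplacian f) (gauss n)) (a : ℝ) :
    Var[fun x => f x - a * ‖x‖ ^ 2; gauss n] =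
      Var[f; gauss n] - 2 * a * ∫ x, Laplacian.laplacian f x ∂gauss n + 2 * n * a ^ 2 := by
  rw [variance_fun_sub hf2 (memLp_two_norm_sq_gauss.const_mul a), covariance_const_mul_right,
    variance_const_mul, covariance_norm_sq_gauss hf hf2 hlap, variance_norm_sq_gauss]
  ring

lemma integrable_inner_gradient_gauss (hf : ContDiff ℝ 1 f)
    (hD : MemLp (fun x => ‖gradient f x‖) 2 (gauss n)) :
    Integrable (fun x => inner ℝ (gradient f x) x) (gauss n) := by
  have hmul : Integrable (fun x => ‖gradient f x‖ * ‖x‖) (gauss n) :=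
    hD.integrable_mul (IsGaussian.memLp_two_id (μ := gauss n)).norm
  exact hmul.mono' ((continuous_gradient hf).inner continuous_id).aestronglyMeasurable
    (.of_forall fun x => norm_inner_le_norm _ _)

lemma norm_gradient_sub_const_mul_norm_sq {x : EuclideanSpace ℝ (Fin n)}
    (hf : DifferentiableAt ℝ f x) (a : ℝ) :
    ‖gradient (fun y => f y - a * ‖y‖ ^ 2) x‖ ^ 2 =
      ‖gradient f x‖ ^ 2 - 4 * a * inner ℝ (gradient f x) x + 4 * a ^ 2 * ‖x‖ ^ 2 := by
  rw [gradient_sub_const_mul_norm_sq hf, norm_sub_sq_real, inner_smul_right, norm_smul,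
    Real.norm_eq_abs, mul_pow, sq_abs]
  ring

lemma integrable_and_integral_norm_gradient_sub_const_mul_norm_sq_gauss (hf : ContDiff ℝ 2 f)
    (hlap : Integrable (Laplacian.laplacian f) (gauss n))
    (hD : MemLp (fun x => ‖gradient f x‖) 2 (gauss n)) (a : ℝ) :
    Integrable (fun x => ‖gradient (fun y => f y - a * ‖y‖ ^ 2) x‖ ^ 2) (gauss n) ∧
      ∫ x, ‖gradient (fun y => f y - a * ‖y‖ ^ 2) x‖ ^ 2 ∂gauss n =
        ∫ x, ‖gradient f x‖ ^ 2 ∂gauss n - 4 * a * ∫ x, Laplacian.laplacian f x ∂gauss n +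
          4 * n * a ^ 2 := by
  have hinner := integrable_inner_gradient_gauss (hf.of_le one_le_two) hD
  have hgreen : ∫ x, Laplacian.laplacian f x ∂gauss n = ∫ x, inner ℝ (gradient f x) x ∂gauss n := by
    simp only [inner_gradient_left] at hinner ⊢
    exact integral_laplacian_gauss_eq_integral_fderiv hf (hD.integrable one_le_two) hinner hlap
  have hdiff : Integrable (fun x => ‖gradient f x‖ ^ 2 - 4 * a * inner ℝ (gradient f x) x)
    (gauss n) := hD.integrable_sq.sub (hinner.const_mul _)
  have hnorm := integrable_norm_sq_gauss (n := n) |>.const_mul (4 * a ^ 2)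
  simp_rw [norm_gradient_sub_const_mul_norm_sq (hf.differentiable two_ne_zero _)]
  refine ⟨hdiff.add hnorm, ?_⟩
  rw [integral_add hdiff hnorm, integral_sub hD.integrable_sq (hinner.const_mul _),
    integral_const_mul, integral_const_mul, integral_norm_sq_gauss, hgreen]
  ring

lemma RefinedTalagrand.memLp_two_and_variance_le_sub (H : RefinedTalagrand n) (hn : 1 ≤ n)
    (hf : ContDiff ℝ 2 f) (hlap : Integrable (Laplacian.laplacian f) (gauss n))
    (hD : MemLp (fun x => ‖gradient f x‖) 2 (gauss n)) :
    MemLp f 2 (gauss n) ∧ Var[f; gauss n] ≤ ∫ x, ‖gradient f x‖ ^ 2 ∂gauss n -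
      1 / (2 * n) * (∫ x, Laplacian.laplacian f x ∂gauss n) ^ 2 := by
  have hpoincare {g : EuclideanSpace ℝ (Fin n) → ℝ} (hg : ContDiff ℝ 2 g)
      (hDg : Integrable (fun x => ‖gradient g x‖ ^ 2) (gauss n)) :
      MemLp g 2 (gauss n) ∧ Var[g; gauss n] ≤ ∫ x, ‖gradient g x‖ ^ 2 ∂gauss n := by
    simp only [norm_gradient] at hDg ⊢
    exact H.memLp_two_and_variance_le hn hg hDg
  have hf2 := (hpoincare hf hD.integrable_sq).1
  refine ⟨hf2, ?_⟩
  obtain ⟨L, hL⟩ : ∃ L, L = ∫ x, Laplacian.laplacian f x ∂gauss n := ⟨_, rfl⟩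
  -- `L / (2 * n)` is the optimal multiple of `‖x‖ ^ 2` to subtract.
  obtain ⟨hint, henergy⟩ := integrable_and_integral_norm_gradient_sub_const_mul_norm_sq_gauss
    hf hlap hD (L / (2 * n))
  have hvar := (hpoincare (hf.sub (contDiff_const.mul (contDiff_norm_sq ℝ))) hint).2
  rw [variance_sub_const_mul_norm_sq_gauss hf hf2 hlap, henergy, ← hL] at hvar
  rw [← hL]
  have : (0 : ℝ) < n := by exact_mod_cast hn
  have hsq : 2 * (L / (2 * n)) * L - 2 * n * (L / (2 * n)) ^ 2 = 1 / (2 * n) * L ^ 2 := by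
    field_simp
    ring
  linarith

theorem RefinedTalagrand.refinedPoincare (H : RefinedTalagrand n) (hn : 1 ≤ n) :
    RefinedPoincare n := by
  intro f hf hlap
  by_cases hfin : ∫⁻ x, ‖gradient f x‖ₑ ^ 2 ∂gauss n = ∞
  · rw [hfin, EReal.coe_ennreal_top, EReal.top_sub_coe]
    exact le_top
  have hgrad := continuous_gradient (hf.of_le one_le_two)
  have hD : MemLp (fun x => ‖gradient f x‖) 2 (gauss n) := by
    rw [memLp_two_iff_integrable_sq hgrad.norm.aestronglyMeasurable]
    refine ⟨(hgrad.norm.pow 2).aestronglyMeasurable, ?_⟩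
    simpa only [hasFiniteIntegral_iff_enorm, enorm_pow, enorm_norm] using lt_top_iff_ne_top.2 hfin
  have henergy : ∫⁻ x, ‖gradient f x‖ₑ ^ 2 ∂gauss n =
      ENNReal.ofReal (∫ x, ‖gradient f x‖ ^ 2 ∂gauss n) := by
    rw [ofReal_integral_eq_lintegral_ofReal hD.integrable_sq (.of_forall fun x => sq_nonneg _)]
    simp_rw [ENNReal.ofReal_pow (norm_nonneg _), ofReal_norm]
  obtain ⟨hf2, hvar⟩ := H.memLp_two_and_variance_le_sub hn hf hlap hD
  rw [henergy, ← hf2.ofReal_variance_eq, EReal.coe_ennreal_ofReal, EReal.coe_ennreal_ofReal,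
    max_eq_left (variance_nonneg _ _), max_eq_left (integral_nonneg fun x => sq_nonneg _),
    ← EReal.coe_sub, EReal.coe_le_coe_iff]
  exact hvar

end RefinedPoincare

end GaussTransport

end

theorem mainTheorem6 (n : ℕ) (hn : 1 ≤ n) :
    GaussTransport.RefinedTalagrand n ∧
      (GaussTransport.RefinedTalagrand n → GaussTransport.ClassicalTalagrand n) ∧
      (GaussTransport.RefinedTalagrand n → GaussTransport.RefinedPoincare n) :=
  ⟨GaussTransport.refinedTalagrand hn, fun _ => GaussTransport.classicalTalagrand n,
    fun H => H.refinedPoincare hn⟩
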